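/- **Theorem (Shannon formula for cardinal exponential splines).** Let $p\ge 1$ be an integer, $N=2p$, and let $\Lambda=[\lambda_1,\dots,\lambda_N]$ be a non-ordered vector of real numbers (repetitions allowed). Assume that either $\Lambda$ is symmetric, i.e. $\Lambda=-\Lambda$ as non-ordered vectors, or that, for some integers $n\ge 1$ and $k$, $\Lambda$ is the vector with entries $$\lambda_{1+j}=k+2j,\qquad \lambda_{1+p+j}=-n-k+2+2j\qquad (j=0,\dots,p-1).$$ Notation. Put $L_\Lambda(\tfrac{d}{dt})=\prod_{j=1}^N(\tfrac{d}{dt}-\lambda_j)$. Let $\mathcal S_\Lambda$ be the space of cardinal exponential splines, i.e. of functions $f\in C^{N-2}(\mathbb R)\cap C^\infty(\mathbb R\setminus\mathbb Z)$, $f:\mathbb R\to\mathbb C$, which on every interval $(j,j+1)$, $j\in\mathbb Z$, coincide with a smooth solution of $L_\Lambda(\tfrac{d}{dt})g=0$ on $\mathbb R$, and let $V_0=\mathcal S_\Lambda\cap L_2(\mathbb R)$. Write $\widehat f(\xi)=\int_{\mathbb R}e^{-i\xi t}f(t)\,dt$. Let $\phi=Q_N[\Lambda]$ be the TB-spline,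 i.e. the continuous function with Fourier transform $$\widehat\phi(\xi)=\prod_{j=1}^N\frac{e^{-\lambda_j}-e^{-i\xi}}{i\xi-\lambda_j},\qquad\text{that is,}\qquad \phi(t)=\frac1{2\pi}\int_{\mathbb R}e^{i\xi t}\prod_{j=1}^N\frac{e^{-\lambda_j}-e^{-i\xi}}{i\xi-\lambda_j}\,d\xi,$$ and let $\phi^*(\xi)=\sum_{j\in\mathbb Z}\phi(j)e^{-i\xi j}$. Let $S_0$ be the Shannon–Walter exponential spline $$S_0(t)=\frac1{2\pi}\int_{\mathbb R}e^{i\xi t}\,\frac{\widehat\phi(\xi)}{\phi^*(\xi)}\,d\xi .$$ Then $\phi^*(\xi)\ne0$ for all $\xi\in\mathbb R$; $S_0$ belongs to $V_0$, is integrable, and satisfies $\widehat{S_0}(\xi)=\widehat\phi(\xi)/\phi^*(\xi)$ for all $\xi\in\mathbb R$; and for every $f\in V_0$ the Shannon type formula $$f(t)=\sum_{j=-\infty}^{\infty}S_0(t-j)\,f(j)\qquad\text{for all }t\in\mathbb R$$ holds, the series being absolutely convergent for every $t$. -/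

import Mathlib

open MeasureTheory Polynomial Complex
open scoped ContDiff FourierTransform

noncomputable section

namespace ExpSpline

/-- The polynomial `L_Λ(z) = ∏ (z - λ_j)` of a non-ordered vector `Λ` of real numbers
(repetitions allowed). -/
def charPoly (Λ : Multiset ℝ) : ℝ[X] :=
  (Λ.map fun l => X - C l).prod

/-- The constant-coefficient differential operator `L_Λ(d/dt) = ∏ (d/dt - λ_j)`, applied to `f`
at the point `t`. -/
def diffOp (Λ : Multiset ℝ) (f : ℝ → ℂ) (t : ℝ) : ℂ :=
  (charPoly Λ).sum fun i a => (a : ℂ) * iteratedDeriv i f t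

/-- The space `U_N(Λ)` of (smooth) solutions of `L_Λ(d/dt) f = 0` on the real line. -/
def solutionSpace (Λ : Multiset ℝ) : Set (ℝ → ℂ) :=
  {f | ContDiff ℝ ∞ f ∧ ∀ t, diffOp Λ f t = 0}

/-- The space `S_Λ` of cardinal exponential splines, for `Λ` of order `N = Λ.card ≥ 2`:
functions in `C^{N-2}(ℝ) ∩ C^∞(ℝ \ ℤ)` whose restriction to every interval `(j, j+1)`
is (the restriction of) an element of `U_N(Λ)`. -/
def cardinalSplines (Λ : Multiset ℝ) : Set (ℝ → ℂ) :=
  {f | ContDiff ℝ ((Λ.card - 2 : ℕ) : ℕ∞) f ∧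
    ContDiffOn ℝ ∞ f (Set.range ((↑) : ℤ → ℝ))ᶜ ∧
    ∀ j : ℤ, ∃ g ∈ solutionSpace Λ, Set.EqOn f g (Set.Ioo (j : ℝ) (j + 1))}

/-- The space `V_0 = S_Λ ∩ L_2(ℝ)`. -/
def V₀ (Λ : Multiset ℝ) : Set (ℝ → ℂ) :=
  {f | f ∈ cardinalSplines Λ ∧ MemLp f 2 volume}

/-- The Fourier transform `f̂(ξ) = ∫ e^{-iξt} f(t) dt`. -/
def fourierHat (f : ℝ → ℂ) (ξ : ℝ) : ℂ :=
  ∫ t : ℝ, exp (-(I * ξ * t)) * f t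

/-- The inverse Fourier transform `(1 / 2π) ∫ e^{iξt} g(ξ) dξ`. -/
def fourierHatInv (g : ℝ → ℂ) (t : ℝ) : ℂ :=
  (1 / (2 * Real.pi) : ℂ) * ∫ ξ : ℝ, exp (I * ξ * t) * g ξ

/-- The function `∏ (e^{-λ_j} - e^{-iξ}) / ∏ (iξ - λ_j)`. (If some `λ_j` vanishes, then `ξ = 0` is
a removable singularity; the function is only used under an integral, where the value at this
single point is irrelevant.) -/
def tbSplineHat (Λ : Multiset ℝ) (ξ : ℝ) : ℂ :=
  (Λ.map fun l : ℝ => exp (-(l : ℂ)) - exp (-(I * ξ))).prod /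
    (Λ.map fun l : ℝ => I * (ξ : ℂ) - (l : ℂ)).prod

/-- The TB-spline `Q_N[Λ]`, for `Λ` of order `N ≥ 2`: the continuous function on the real line
with Fourier transform `∏ (e^{-λ_j} - e^{-iξ}) / ∏ (iξ - λ_j)`. It is the scaling function `φ`. -/
def tbSpline (Λ : Multiset ℝ) : ℝ → ℂ :=
  fourierHatInv (tbSplineHat Λ)

/-- The function `φ*(ξ) = ∑_j φ(j) e^{-iξj}`, where `φ = Q_N[Λ]`. -/
def phiStar (Λ : Multiset ℝ) (ξ : ℝ) : ℂ :=
  ∑' j : ℤ, tbSpline Λ (j : ℝ) * exp (-(I * ξ * j))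

/-- The Shannon–Walter exponential spline `S_0`: the function with Fourier transform `φ̂ / φ*`. -/
def shannonWalter (Λ : Multiset ℝ) : ℝ → ℂ :=
  fourierHatInv fun ξ => fourierHat (tbSpline Λ) ξ / phiStar Λ ξ

/-- `Λ` is symmetric: `Λ = -Λ` as non-ordered vectors. -/
def IsSymmetric (Λ : Multiset ℝ) : Prop :=
  Λ.map (fun l => -l) = Λ

/-- The nearly symmetric vector of order `2p` with entries `k + 2j` and `-n - k + 2 + 2j`,
`j = 0, …, p - 1`. -/
def nearlySymmetric (n p : ℕ) (k : ℤ) : Multiset ℝ :=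
  ((Multiset.range p).map fun j => (k : ℝ) + 2 * j) +
    ((Multiset.range p).map fun j => -(n : ℝ) - k + 2 + 2 * j)

/-- The relation of `fourierHat` with Mathlib's Fourier transform. -/
theorem fourierHat_eq (f : ℝ → ℂ) (ξ : ℝ) :
    fourierHat f ξ = 𝓕 f (ξ / (2 * Real.pi)) := by
  rw [Real.fourier_eq', fourierHat]
  congr 1
  ext t
  have h : (Real.pi : ℂ) ≠ 0 := by exact_mod_cast Real.pi_ne_zero
  simp only [smul_eq_mul]
  congr 2
  simp
  field_simp

end ExpSpline

end

/-!
Every cardinal exponential spline is a series `∑ j, a j * B (t - j)` of translates of the B-spline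
`B = Q_N[Λ]` (`exists_eq_splineSeries`), with uniquely determined coefficients: even its restriction
to one unit interval determines all the coefficients that matter there (`coeff_eq_zero_of_eqOn`).
Hence square-integrable splines have bounded coefficients (`exists_norm_coeff_le`). These facts hold
for any real exponents and are proved one exponent at a time, with `d/dt - l` acting on splines as a
difference operator on coefficients.

The hypothesis on `Λ` is needed for `φ*(ξ) ≠ 0`. This number is the value at `0` of the series with
coefficients `w ^ j`, where `w = exp (I * ξ)` (`phiStar_eq`).
* If `w` is not real, that series moves around the origin in one sense, and each integration over a
  window of length one preserves this (`cross_window_integral_nonneg`); the case of equality would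
  contradict local linear independence (`splineSeries_zpow_ne_zero_of_im_ne_zero`).
* If `w = 1`, the series is positive.
* If `w = -1` and `Λ` is symmetric, write `Λ = M + (-M)`. Integration by parts identifies the value,
  up to a factor, with the integral over a period of the square of the antiperiodic spline for `M`,
  which is positive (`altSeries_ne_zero_of_eq_add_neg`).
* If `w = -1` and `Λ` is nearly symmetric but not symmetric, the value is, up to a nonzero factor, the
  divided difference of `1 / (1 + exp x)` at the entries of `Λ`. These are integers, so the divided
  difference is a rational function of `e`. Exactly one integer `μ` among the entries has maximal
  absolute value, and `μ ≠ 0`; therefore the rational function has a pole at `ζ = exp (π * I / μ)`,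
  so it is not identically zero, and it does not vanish at `e`, which is transcendental
  (`intAltValue_ne_zero`, `transcendental_exp_one`).

So the trigonometric polynomial `φ*` has no zeros, and its zero-free symbol is inverted by a summable
sequence `c` (`exists_fundamental_coeff`). The spline `∑ j, c j * B (t - j)` is integrable and has the
Fourier transform `φ̂ / φ*`, so it is `S₀` (`shannonWalter_eq`). For `f = ∑ l, a l * B (t - l)` with
bounded `a`, the Shannon formula follows by interchanging an absolutely convergent series with the
finite sum that expresses `f j` through the coefficients (`hasSum_splineSeries_mul_intCast`).
-/

noncomputable section

namespace ExpSpline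

/-! ### Series of translates of B-splines -/

section

/-- The series `∑ j, a j * B (t - j)` of integer translates of the B-spline `B` whose exponents are
`l₀` and the entries of `L` (so its order is `L.length + 1`), written without the infinite sum.

For a single exponent it is the piecewise function `a ⌊t⌋ * exp (l₀ * (fract t - 1))`; a further
exponent `l` convolves with `exp (l * (u - 1))` on `0 < u ≤ 1`. This convolution is the integral over
a window of length one, so every value is defined, whatever the growth of `a`. The first exponent
`l₀` is kept apart because the order is at least one. -/
def splineSeries (l₀ : ℝ) : List ℝ → (ℤ → ℂ) → ℝ → ℂ
  | [], a, t => a ⌊t⌋ * (Real.exp (l₀ * (Int.fract t - 1)) : ℝ)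
  | l :: L, a, t => (Real.exp (l * (t - 1)) : ℝ) *
      ∫ s in (t - 1)..t, (Real.exp (-(l * s)) : ℝ) * splineSeries l₀ L a s

variable {l₀ l : ℝ} {L : List ℝ} {a b : ℤ → ℂ} {t s : ℝ}

theorem splineSeries_nil : splineSeries l₀ [] a t =
    a ⌊t⌋ * (Real.exp (l₀ * (Int.fract t - 1)) : ℝ) := rfl

theorem splineSeries_cons : splineSeries l₀ (l :: L) a t = (Real.exp (l * (t - 1)) : ℝ) *
      ∫ s in (t - 1)..t, (Real.exp (-(l * s)) : ℝ) * splineSeries l₀ L a s := rfl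

/-- The value at `t` depends on the coefficients with indices `⌊t⌋ - L.length, …, ⌊t⌋` only. -/
theorem splineSeries_congr (h : ∀ j : ℤ, ⌊t⌋ - L.length ≤ j → j ≤ ⌊t⌋ → a j = b j) :
    splineSeries l₀ L a t = splineSeries l₀ L b t := by
  induction L generalizing t with
  | nil => simp [splineSeries_nil, h ⌊t⌋ (by simp) le_rfl]
  | cons l L ih =>
    rw [splineSeries_cons, splineSeries_cons]
    congr 1
    refine intervalIntegral.integral_congr fun s hs => ?_
    rw [Set.uIcc_of_le (by linarith)] at hs
    have h1 : ⌊s⌋ ≤ ⌊t⌋ := Int.floor_le_floor hs.2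
    have h2 : ⌊t⌋ - 1 ≤ ⌊s⌋ := by
      have := Int.floor_le_floor hs.1
      rwa [Int.floor_sub_one] at this
    rw [ih fun j hj hj' => h j ?_ (hj'.trans h1)]
    push_cast [List.length_cons]
    omega

theorem splineSeries_zero : splineSeries l₀ L 0 t = 0 := by
  induction L generalizing t with
  | nil => simp [splineSeries_nil]
  | cons l L ih => simp [splineSeries_cons, ih]

theorem splineSeries_eq_zero (h : ∀ j : ℤ, ⌊t⌋ - L.length ≤ j → j ≤ ⌊t⌋ → a j = 0) :
    splineSeries l₀ L a t = 0 :=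
  (splineSeries_congr (b := 0) h).trans splineSeries_zero

theorem splineSeries_add_int (k : ℤ) :
    splineSeries l₀ L a (t + k) = splineSeries l₀ L (fun j => a (j + k)) t := by
  induction L generalizing t with
  | nil => simp [splineSeries_nil]
  | cons l L ih =>
    rw [splineSeries_cons, splineSeries_cons]
    have h := intervalIntegral.integral_comp_add_right (a := t - 1) (b := t)
      (fun s => ((Real.exp (-(l * s)) : ℝ) : ℂ) * splineSeries l₀ L a s) (k : ℝ)
    rw [show t + (k : ℝ) - 1 = t - 1 + k by ring, ← h]
    simp_rw [ih, ← intervalIntegral.integral_const_mul, ← mul_assoc, ← ofReal_mul, ← Real.exp_add]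
    refine intervalIntegral.integral_congr fun s _ => ?_
    congr 3
    ring

/-- A bound on the coefficients is a bound on the spline, up to a factor that depends on the
exponents only. -/
theorem exists_norm_splineSeries_le (l₀ : ℝ) (L : List ℝ) :
    ∃ C : ℝ, 0 ≤ C ∧ ∀ (a : ℤ → ℂ) (M : ℝ), (∀ j, ‖a j‖ ≤ M) → ∀ t,
      ‖splineSeries l₀ L a t‖ ≤ C * M := by
  induction L with
  | nil =>
    refine ⟨Real.exp |l₀|, by positivity, fun a M hM t => ?_⟩
    rw [splineSeries_nil, norm_mul, norm_real, Real.norm_of_nonneg (by positivity), mul_comm]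
    gcongr
    · calc l₀ * (Int.fract t - 1) ≤ |l₀ * (Int.fract t - 1)| := le_abs_self _
        _ = |l₀| * |Int.fract t - 1| := abs_mul _ _
        _ ≤ |l₀| * 1 := by
          gcongr
          rw [abs_le]
          constructor <;> linarith [Int.fract_nonneg t, Int.fract_lt_one t]
        _ = |l₀| := mul_one _
    · exact hM _
  | cons l L ih =>
    obtain ⟨C, hC, h⟩ := ih
    refine ⟨Real.exp |l| * C, by positivity, fun a M hM t => ?_⟩
    rw [splineSeries_cons, ← intervalIntegral.integral_const_mul]
    refine (intervalIntegral.norm_integral_le_of_norm_le_const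
      (C := Real.exp |l| * C * M) fun s hs => ?_).trans (by simp)
    rw [Set.uIoc_of_le (by linarith)] at hs
    rw [← mul_assoc, ← ofReal_mul, ← Real.exp_add, norm_mul, norm_real,
      Real.norm_of_nonneg (by positivity), mul_assoc]
    gcongr
    · calc l * (t - 1) + -(l * s) = l * (t - 1 - s) := by ring
        _ ≤ |l * (t - 1 - s)| := le_abs_self _
        _ = |l| * |t - 1 - s| := abs_mul _ _
        _ ≤ |l| * 1 := by
          gcongr
          rw [abs_le]
          constructor <;> linarith [hs.1, hs.2]
        _ = |l| := mul_one _
    · exact h a M hM s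

/-- On a bounded interval only finitely many coefficients matter. -/
theorem exists_norm_splineSeries_le_on_Icc (l₀ : ℝ) (L : List ℝ) (a : ℤ → ℂ) (x y : ℝ) :
    ∃ M : ℝ, ∀ t ∈ Set.Icc x y, ‖splineSeries l₀ L a t‖ ≤ M := by
  obtain ⟨C, hC, h⟩ := exists_norm_splineSeries_le l₀ L
  set W : Finset ℤ := Finset.Icc (⌊x⌋ - L.length) ⌊y⌋ with hW
  refine ⟨C * ∑ j ∈ W, ‖a j‖, fun t ht => ?_⟩
  rw [splineSeries_congr (b := fun j => if j ∈ W then a j else 0)]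
  · refine h _ _ (fun j => ?_) t
    split_ifs with hj
    · exact Finset.single_le_sum (f := fun j => ‖a j‖) (fun _ _ => norm_nonneg _) hj
    · simp only [norm_zero]
      positivity
  · intro j h1 h2
    have h3 := Int.floor_le_floor ht.1
    have h4 := Int.floor_le_floor ht.2
    rw [if_pos]
    rw [hW, Finset.mem_Icc]
    omega

/-- Measurability, local integrability and continuity are proved together: each integration needs
local integrability, and gives continuity from the second exponent on. -/
theorem intervalIntegrable_and_continuous (l₀ : ℝ) (L : List ℝ) (a : ℤ → ℂ) :
    (Measurable (splineSeries l₀ L a) ∧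
      ∀ x y, IntervalIntegrable (splineSeries l₀ L a) volume x y) ∧
    ∀ l, Continuous (splineSeries l₀ (l :: L) a) := by
  have key : ∀ L, Measurable (splineSeries l₀ L a) →
      ∀ x y, IntervalIntegrable (splineSeries l₀ L a) volume x y := by
    intro L hm x y
    obtain ⟨M, hM⟩ := exists_norm_splineSeries_le_on_Icc l₀ L a (min x y) (max x y)
    rw [intervalIntegrable_iff]
    refine Measure.integrableOn_of_bounded (M := M) (by simp) hm.aestronglyMeasurable ?_
    refine (ae_restrict_iff' measurableSet_uIoc).2 (ae_of_all _ fun t ht => hM t ?_)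
    exact Set.Ioc_subset_Icc_self ht
  have key2 : ∀ L, (∀ x y, IntervalIntegrable (splineSeries l₀ L a) volume x y) →
      ∀ l, Continuous (splineSeries l₀ (l :: L) a) := by
    intro L hi l
    have hi' : ∀ x y, IntervalIntegrable
        (fun s => ((Real.exp (-(l * s)) : ℝ) : ℂ) * splineSeries l₀ L a s) volume x y :=
      fun x y => (hi x y).continuousOn_mul (by fun_prop)
    have hc := intervalIntegral.continuous_primitive hi' 0
    have : splineSeries l₀ (l :: L) a = fun t => ((Real.exp (l * (t - 1)) : ℝ) : ℂ) *
        ((∫ s in (0 : ℝ)..t, ((Real.exp (-(l * s)) : ℝ) : ℂ) * splineSeries l₀ L a s) -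
        ∫ s in (0 : ℝ)..(t - 1), ((Real.exp (-(l * s)) : ℝ) : ℂ) * splineSeries l₀ L a s) := by
      ext t
      rw [splineSeries_cons, intervalIntegral.integral_interval_sub_left (hi' _ _) (hi' _ _)]
    rw [this]
    have hc2 := hc.comp (show Continuous fun t : ℝ => t - 1 by fun_prop)
    exact (by fun_prop : Continuous fun t : ℝ => ((Real.exp (l * (t - 1)) : ℝ) : ℂ)).mul
      (hc.sub hc2)
  induction L with
  | nil =>
    have hm : Measurable (splineSeries l₀ [] a) := by
      have h1 : Measurable fun t : ℝ => a ⌊t⌋ :=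
        (measurable_from_top (f := a)).comp Int.measurable_floor
      have h2 : Measurable fun t : ℝ => ((Real.exp (l₀ * (Int.fract t - 1)) : ℝ) : ℂ) := by
        have := measurable_fract (R := ℝ)
        fun_prop
      exact h1.mul h2
    exact ⟨⟨hm, key _ hm⟩, key2 _ (key _ hm)⟩
  | cons l L ih => exact ⟨⟨(ih.2 l).measurable, key _ (ih.2 l).measurable⟩,
      key2 _ (key _ (ih.2 l).measurable)⟩

theorem measurable_splineSeries (l₀ : ℝ) (L : List ℝ) (a : ℤ → ℂ) :
    Measurable (splineSeries l₀ L a) := (intervalIntegrable_and_continuous l₀ L a).1.1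

theorem intervalIntegrable_splineSeries (l₀ : ℝ) (L : List ℝ) (a : ℤ → ℂ) (x y : ℝ) :
    IntervalIntegrable (splineSeries l₀ L a) volume x y :=
  (intervalIntegrable_and_continuous l₀ L a).1.2 x y

theorem continuous_splineSeries_cons (l₀ l : ℝ) (L : List ℝ) (a : ℤ → ℂ) :
    Continuous (splineSeries l₀ (l :: L) a) := (intervalIntegrable_and_continuous l₀ L a).2 l

theorem intervalIntegrable_exp_mul_splineSeries (c l₀ : ℝ) (L : List ℝ) (a : ℤ → ℂ) (x y : ℝ) :
    IntervalIntegrable (fun s => ((Real.exp (-(c * s)) : ℝ) : ℂ) * splineSeries l₀ L a s)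
      volume x y :=
  (intervalIntegrable_splineSeries l₀ L a x y).continuousOn_mul (by fun_prop)

theorem splineSeries_add : splineSeries l₀ L (fun j => a j + b j) t =
    splineSeries l₀ L a t + splineSeries l₀ L b t := by
  induction L generalizing t with
  | nil => simp only [splineSeries_nil, add_mul]
  | cons l L ih =>
    simp only [splineSeries_cons, ih, mul_add]
    rw [intervalIntegral.integral_add (intervalIntegrable_exp_mul_splineSeries ..)
      (intervalIntegrable_exp_mul_splineSeries ..), mul_add]

theorem splineSeries_const_mul (c : ℂ) : splineSeries l₀ L (fun j => c * a j) t =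
    c * splineSeries l₀ L a t := by
  induction L generalizing t with
  | nil => simp only [splineSeries_nil, mul_assoc]
  | cons l L ih =>
    simp only [splineSeries_cons, ih, mul_left_comm _ c]
    rw [intervalIntegral.integral_const_mul, mul_left_comm]

theorem splineSeries_sub : splineSeries l₀ L (fun j => a j - b j) t =
    splineSeries l₀ L a t - splineSeries l₀ L b t := by
  have := splineSeries_add (l₀ := l₀) (L := L) (a := a) (b := fun j => (-1) * b j) (t := t)
  rw [splineSeries_const_mul] at this
  simpa [sub_eq_add_neg] using this

/-- The coefficients of the series obtained by applying `d/dt - l` to a series that has the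
exponent `l` among its exponents; see `exp_mul_splineSeries_cons`. -/
def coeffDiff (l : ℝ) (a : ℤ → ℂ) (j : ℤ) : ℂ := (Real.exp (-l) : ℝ) * a j - a (j - 1)

theorem splineSeries_coeffDiff : splineSeries l₀ L (coeffDiff l a) t =
    (Real.exp (-l) : ℝ) * splineSeries l₀ L a t - splineSeries l₀ L a (t - 1) := by
  have h := splineSeries_add_int (l₀ := l₀) (L := L) (a := a) (t := t) (-1)
  simp only [Int.cast_neg, Int.cast_one, ← sub_eq_add_neg] at h
  rw [h, ← splineSeries_const_mul, ← splineSeries_sub]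
  rfl

/-- The identity `(d/dt - l) F_{l, L}[a] = F_L[coeffDiff l a]` in integrated form. In this form it
also holds when `L = []` and the right-hand side jumps at the integers. -/
theorem exp_mul_splineSeries_cons (s t : ℝ) :
    (Real.exp (-(l * s)) : ℝ) * splineSeries l₀ (l :: L) a s =
      (Real.exp (-(l * t)) : ℝ) * splineSeries l₀ (l :: L) a t +
        ∫ u in t..s, (Real.exp (-(l * u)) : ℝ) * splineSeries l₀ L (coeffDiff l a) u := by
  set f : ℝ → ℂ := fun u => (Real.exp (-(l * u)) : ℝ) * splineSeries l₀ L a u with hf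
  have hfi : ∀ x y, IntervalIntegrable f volume x y := fun x y =>
    intervalIntegrable_exp_mul_splineSeries ..
  have h1 : ∀ r : ℝ, ((Real.exp (-(l * r)) : ℝ) : ℂ) * splineSeries l₀ (l :: L) a r =
      (Real.exp (-l) : ℝ) * ∫ u in (r - 1)..r, f u := by
    intro r
    rw [splineSeries_cons, ← mul_assoc, ← ofReal_mul, ← Real.exp_add]
    congr 4
    ring
  have h2 : ∀ u : ℝ, ((Real.exp (-(l * u)) : ℝ) : ℂ) * splineSeries l₀ L (coeffDiff l a) u =
      (Real.exp (-l) : ℝ) * f u - (Real.exp (-l) : ℝ) * f (u - 1) := by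
    intro u
    rw [splineSeries_coeffDiff, hf]
    simp only
    rw [mul_sub, mul_left_comm, ← mul_assoc ((Real.exp (-l) : ℝ) : ℂ) _ (splineSeries l₀ L a (u - 1)),
      ← ofReal_mul, ← Real.exp_add]
    congr 4
    ring_nf
  have hfi' : ∀ x y, IntervalIntegrable (fun u => f (u - 1)) volume x y := fun x y => by
    simpa using (hfi (x - 1) (y - 1)).comp_sub_right 1
  simp_rw [h1, h2]
  rw [intervalIntegral.integral_sub ((hfi _ _).const_mul _) ((hfi' _ _).const_mul _),
    intervalIntegral.integral_const_mul, intervalIntegral.integral_const_mul,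
    intervalIntegral.integral_comp_sub_right, ← mul_sub, ← mul_add]
  congr 1
  rw [← sub_eq_iff_eq_add',
    intervalIntegral.integral_interval_sub_interval_comm' (hfi _ _) (hfi _ _) (hfi _ _)]

theorem splineSeries_re_pos (h : ∀ j, 0 < (a j).re) : 0 < (splineSeries l₀ L a t).re := by
  induction L generalizing t with
  | nil =>
    rw [splineSeries_nil, re_mul_ofReal]
    exact mul_pos (h _) (Real.exp_pos _)
  | cons l L ih =>
    rw [splineSeries_cons, re_ofReal_mul]
    refine mul_pos (Real.exp_pos _) ?_
    have hi := intervalIntegrable_exp_mul_splineSeries l l₀ L a (t - 1) t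
    have := Complex.reCLM.intervalIntegral_comp_comm hi
    simp only [reCLM_apply] at this
    rw [← this]
    refine intervalIntegral.intervalIntegral_pos_of_pos ⟨hi.1.re, hi.2.re⟩ (fun s => ?_) (by linarith)
    rw [re_ofReal_mul]
    exact mul_pos (Real.exp_pos _) ih

theorem splineSeries_im_eq_zero (h : ∀ j, (a j).im = 0) : (splineSeries l₀ L a t).im = 0 := by
  induction L generalizing t with
  | nil => rw [splineSeries_nil, im_mul_ofReal, h, zero_mul]
  | cons l L ih =>
    rw [splineSeries_cons, im_ofReal_mul]
    have hi := intervalIntegrable_exp_mul_splineSeries l l₀ L a (t - 1) t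
    have := Complex.imCLM.intervalIntegral_comp_comm hi
    simp only [imCLM_apply] at this
    rw [← this]
    simp_rw [im_ofReal_mul, ih, mul_zero]
    simp

end

/-! ### Local solutions and local linear independence -/

section

variable {l₀ l : ℝ} {L : List ℝ} {a b : ℤ → ℂ} {t s : ℝ} {f g : ℝ → ℂ} {Λ : Multiset ℝ}

theorem charPoly_cons (l : ℝ) (Λ : Multiset ℝ) : charPoly (l ::ₘ Λ) = (X - C l) * charPoly Λ := by
  simp [charPoly]

theorem sum_X_sub_C_mul (q : ℝ[X]) (l : ℝ) (c : ℕ → ℂ) :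
    ((X - C l) * q).sum (fun i r => (r : ℂ) * c i) =
      q.sum fun i r => (r : ℂ) * (c (i + 1) - l * c i) := by
  have hadd : ∀ (c : ℕ → ℂ) (p q : ℝ[X]), (p + q).sum (fun i r => (r : ℂ) * c i) =
      p.sum (fun i r => (r : ℂ) * c i) + q.sum (fun i r => (r : ℂ) * c i) := fun c p q =>
    sum_add_index p q _ (by simp) (by intros; push_cast; ring)
  have hmon : ∀ (c : ℕ → ℂ) (n : ℕ) (r : ℝ),
      (monomial n r).sum (fun i r => (r : ℂ) * c i) = r * c n := fun c n r =>
    sum_monomial_index r _ (by simp)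
  induction q using Polynomial.induction_on' with
  | add p q hp hq => rw [mul_add, hadd, hp, hq, hadd fun i => c (i + 1) - l * c i]
  | monomial n r =>
    have : (X - C l) * monomial n r = monomial (n + 1) r + monomial n (-(l * r)) := by
      rw [sub_mul, X_mul_monomial, C_mul_monomial, map_neg, sub_eq_add_neg]
    rw [this, hadd, hmon, hmon, hmon fun i => c (i + 1) - l * c i]
    push_cast
    ring

theorem iteratedDeriv_deriv_sub_mul (hg : ContDiff ℝ ∞ g) (l : ℝ) (i : ℕ) :
    iteratedDeriv i (fun t => deriv g t - l * g t) t =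
      iteratedDeriv (i + 1) g t - l * iteratedDeriv i g t := by
  have h1 : ContDiff ℝ ∞ (deriv g) := (contDiff_infty_iff_deriv.1 hg).2
  have h2 : ContDiff ℝ ∞ fun t => (l : ℂ) * g t := contDiff_const.mul hg
  rw [iteratedDeriv_fun_sub ((h1.of_le (by exact_mod_cast le_top)).contDiffAt)
    ((h2.of_le (by exact_mod_cast le_top)).contDiffAt),
    iteratedDeriv_succ', iteratedDeriv_const_mul_field]

/-- Solution spaces can be handled one exponent at a time. -/
theorem mem_solutionSpace_cons : g ∈ solutionSpace (l ::ₘ Λ) ↔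
    ContDiff ℝ ∞ g ∧ (fun t => deriv g t - l * g t) ∈ solutionSpace Λ := by
  refine and_congr_right fun hg => ?_
  have h1 : ContDiff ℝ ∞ (deriv g) := (contDiff_infty_iff_deriv.1 hg).2
  have h2 : ContDiff ℝ ∞ fun t => deriv g t - l * g t := h1.sub (contDiff_const.mul hg)
  have : ∀ t, diffOp (l ::ₘ Λ) g t = diffOp Λ (fun t => deriv g t - l * g t) t := by
    intro t
    unfold diffOp
    simp only [iteratedDeriv_deriv_sub_mul hg]
    rw [charPoly_cons, sum_X_sub_C_mul]
  simp only [this]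
  exact ⟨fun h => ⟨h2, h⟩, fun h => h.2⟩

theorem mem_solutionSpace_zero : g ∈ solutionSpace 0 ↔ g = 0 := by
  have : ∀ g t, diffOp 0 g t = g t := by
    intro g t
    simp only [diffOp, charPoly, Multiset.map_zero, Multiset.prod_zero]
    rw [← C_1, sum_C_index (by simp)]
    simp
  constructor
  · exact fun h => funext fun t => (this g t).symm.trans (h.2 t)
  · rintro rfl
    exact ⟨contDiff_const, fun t => this _ _⟩

/-- The integrated form of `(d/dt - l) g`, to be compared with `exp_mul_splineSeries_cons`. -/
theorem exp_mul_eq_add_integral (hg : ContDiff ℝ ∞ g) (l s t : ℝ) :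
    (Real.exp (-(l * s)) : ℝ) * g s = (Real.exp (-(l * t)) : ℝ) * g t +
      ∫ u in t..s, (Real.exp (-(l * u)) : ℝ) * (deriv g u - l * g u) := by
  have hd := contDiff_infty_iff_deriv.1 hg
  rw [intervalIntegral.integral_eq_sub_of_hasDerivAt
    (f := fun u : ℝ => ((Real.exp (-(l * u)) : ℝ) : ℂ) * g u)]
  · ring
  · intro u _
    have h1 : HasDerivAt (fun u : ℝ => ((Real.exp (-(l * u)) : ℝ) : ℂ))
        ((Real.exp (-(l * u)) * -(l * 1) : ℝ) : ℂ) u :=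
      (((hasDerivAt_id u).const_mul l).neg.exp).ofReal_comp
    refine (h1.mul (hd.1 u).hasDerivAt).congr_deriv ?_
    push_cast
    ring
  · have := hd.2.continuous
    have := hg.continuous
    apply Continuous.intervalIntegrable
    fun_prop

theorem hasDerivAt_exp_mul {A : ℝ → ℂ} {A' : ℂ} (l t : ℝ) (h : HasDerivAt A A' t) :
    HasDerivAt (fun t : ℝ => ((Real.exp (l * t) : ℝ) : ℂ) * A t)
      (l * (((Real.exp (l * t) : ℝ) : ℂ) * A t) + (Real.exp (l * t) : ℝ) * A') t := by
  have h1 : HasDerivAt (fun u : ℝ => ((Real.exp (l * u) : ℝ) : ℂ))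
      ((Real.exp (l * t) * (l * 1) : ℝ) : ℂ) t :=
    (((hasDerivAt_id t).const_mul l).exp).ofReal_comp
  refine (h1.mul h).congr_deriv ?_
  push_cast
  ring

theorem exp_mul_exp_neg (l t : ℝ) (z : ℂ) :
    ((Real.exp (l * t) : ℝ) : ℂ) * (((Real.exp (-(l * t)) : ℝ) : ℂ) * z) = z := by
  rw [← mul_assoc, ← ofReal_mul, ← Real.exp_add]
  simp

/-- On every half-open unit interval a spline series is a global smooth solution of
`L_Λ(d/dt) g = 0`. -/
theorem exists_eqOn_Ico (l₀ : ℝ) (L : List ℝ) (a : ℤ → ℂ) (j : ℤ) :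
    ∃ g ∈ solutionSpace (l₀ ::ₘ (L : Multiset ℝ)),
      Set.EqOn (splineSeries l₀ L a) g (Set.Ico (j : ℝ) (j + 1)) := by
  induction L generalizing a with
  | nil =>
    set c : ℂ := a j * (Real.exp (-(l₀ * (j + 1))) : ℝ) with hc
    have hd : ∀ t : ℝ, HasDerivAt (fun t : ℝ => ((Real.exp (l₀ * t) : ℝ) : ℂ) * c)
        (l₀ * (((Real.exp (l₀ * t) : ℝ) : ℂ) * c)) t := by
      intro t
      simpa using hasDerivAt_exp_mul l₀ t (hasDerivAt_const t c)
    refine ⟨fun t => (Real.exp (l₀ * t) : ℝ) * c, mem_solutionSpace_cons.2 ⟨?_, ?_⟩, ?_⟩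
    · have : ContDiff ℝ ∞ fun t : ℝ => Real.exp (l₀ * t) :=
        (contDiff_const.mul contDiff_id).exp
      exact (ofRealCLM.contDiff.comp this).mul contDiff_const
    · rw [Multiset.coe_nil, mem_solutionSpace_zero]
      ext t
      rw [(hd t).deriv]
      simp
    · intro t ht
      have hf : ⌊t⌋ = j := Int.floor_eq_iff.2 ⟨ht.1, ht.2⟩
      simp only [splineSeries_nil, hf, hc, Int.fract]
      rw [mul_left_comm, ← ofReal_mul, ← Real.exp_add]
      congr 3
      ring
  | cons l L ih =>
    obtain ⟨g, hg, hga⟩ := ih (coeffDiff l a)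
    have hgc : Continuous g := hg.1.continuous
    set A : ℝ → ℂ := fun t => (Real.exp (-(l * j)) : ℝ) * splineSeries l₀ (l :: L) a j +
      ∫ u in (j : ℝ)..t, (Real.exp (-(l * u)) : ℝ) * g u with hA
    have hAd : ∀ t, HasDerivAt A ((Real.exp (-(l * t)) : ℝ) * g t) t := by
      intro t
      have hcont : Continuous fun u : ℝ => ((Real.exp (-(l * u)) : ℝ) : ℂ) * g u := by fun_prop
      exact ((hcont.integral_hasStrictDerivAt _ _).hasDerivAt).const_add _
    have hd : ∀ t : ℝ, HasDerivAt (fun t : ℝ => ((Real.exp (l * t) : ℝ) : ℂ) * A t)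
        (l * (((Real.exp (l * t) : ℝ) : ℂ) * A t) + g t) t := by
      intro t
      simpa only [exp_mul_exp_neg] using hasDerivAt_exp_mul l t (hAd t)
    have hAc : ContDiff ℝ ∞ A := by
      rw [contDiff_infty_iff_deriv]
      refine ⟨fun t => (hAd t).differentiableAt, ?_⟩
      rw [funext fun t => (hAd t).deriv]
      exact (ofRealCLM.contDiff.comp ((contDiff_const.mul contDiff_id).neg.exp)).mul hg.1
    refine ⟨fun t => (Real.exp (l * t) : ℝ) * A t, ?_, ?_⟩
    · rw [← Multiset.cons_coe, Multiset.cons_swap, mem_solutionSpace_cons]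
      refine ⟨(ofRealCLM.contDiff.comp ((contDiff_const.mul contDiff_id).exp)).mul hAc, ?_⟩
      convert hg using 1
      ext t
      rw [(hd t).deriv]
      simp
    · intro t ht
      have h := exp_mul_splineSeries_cons (l₀ := l₀) (l := l) (L := L) (a := a) t j
      have hint : ∫ u in (j : ℝ)..t, ((Real.exp (-(l * u)) : ℝ) : ℂ) *
          splineSeries l₀ L (coeffDiff l a) u =
          ∫ u in (j : ℝ)..t, ((Real.exp (-(l * u)) : ℝ) : ℂ) * g u := by
        refine intervalIntegral.integral_congr fun u hu => ?_
        rw [Set.uIcc_of_le ht.1] at hu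
        rw [hga ⟨hu.1, hu.2.trans_lt ht.2⟩]
      rw [hint] at h
      simp only [hA]
      rw [← h, exp_mul_exp_neg]

theorem hasDerivAt_splineSeries (l₀ l m : ℝ) (L : List ℝ) (a : ℤ → ℂ) (t : ℝ) :
    HasDerivAt (splineSeries l₀ (l :: m :: L) a) (l * splineSeries l₀ (l :: m :: L) a t +
      splineSeries l₀ (m :: L) (coeffDiff l a) t) t := by
  have hcont : Continuous fun u : ℝ => ((Real.exp (-(l * u)) : ℝ) : ℂ) *
      splineSeries l₀ (m :: L) (coeffDiff l a) u := by
    have := continuous_splineSeries_cons l₀ m L (coeffDiff l a)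
    fun_prop
  have h := hasDerivAt_exp_mul l t (((hcont.integral_hasStrictDerivAt 0 t).hasDerivAt).const_add
    ((Real.exp (-(l * 0)) : ℝ) * splineSeries l₀ (l :: m :: L) a 0))
  simp only [← exp_mul_splineSeries_cons, exp_mul_exp_neg] at h
  exact h

theorem contDiff_splineSeries (l₀ l : ℝ) (L : List ℝ) (a : ℤ → ℂ) :
    ContDiff ℝ L.length (splineSeries l₀ (l :: L) a) := by
  induction L generalizing l a with
  | nil => exact contDiff_zero.2 (continuous_splineSeries_cons ..)
  | cons m L ih =>
    have hd := hasDerivAt_splineSeries l₀ l m L a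
    have aux : ∀ n : ℕ, n ≤ L.length + 1 → ContDiff ℝ n (splineSeries l₀ (l :: m :: L) a) := by
      intro n
      induction n with
      | zero => exact fun _ => contDiff_zero.2 (continuous_splineSeries_cons ..)
      | succ n ihn =>
        intro hn
        push_cast
        rw [contDiff_succ_iff_deriv]
        refine ⟨fun t => (hd t).differentiableAt, by simp, ?_⟩
        rw [funext fun t => (hd t).deriv]
        exact (contDiff_const.mul (ihn (by omega))).add
          ((ih m _).of_le (by exact_mod_cast (by omega : n ≤ L.length)))
    simpa using aux (L.length + 1) le_rfl

/-- The converse is `exists_eq_splineSeries`. -/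
theorem splineSeries_mem_cardinalSplines (l₀ l : ℝ) (L : List ℝ) (a : ℤ → ℂ) :
    splineSeries l₀ (l :: L) a ∈ cardinalSplines (l₀ ::ₘ ((l :: L : List ℝ) : Multiset ℝ)) := by
  refine ⟨?_, ?_, fun j => ?_⟩
  · have := contDiff_splineSeries l₀ l L a
    simpa using this
  · intro t ht
    obtain ⟨g, hg, h⟩ := exists_eqOn_Ico l₀ (l :: L) a ⌊t⌋
    have hlt : (⌊t⌋ : ℝ) < t := lt_of_le_of_ne (Int.floor_le t) fun h => ht ⟨_, h⟩
    have : splineSeries l₀ (l :: L) a =ᶠ[nhds t] g := by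
      filter_upwards [Ioo_mem_nhds hlt (Int.lt_floor_add_one t)] with u hu
      exact h (Set.Ioo_subset_Ico_self hu)
    exact (hg.1.contDiffAt.congr_of_eventuallyEq this).contDiffWithinAt
  · obtain ⟨g, hg, h⟩ := exists_eqOn_Ico l₀ (l :: L) a j
    exact ⟨g, hg, h.mono Set.Ioo_subset_Ico_self⟩

theorem continuousWithinAt_splineSeries (l₀ : ℝ) (L : List ℝ) (a : ℤ → ℂ) (t : ℝ) :
    ContinuousWithinAt (splineSeries l₀ L a) (Set.Ioi t) t := by
  obtain ⟨g, hg, h⟩ := exists_eqOn_Ico l₀ L a ⌊t⌋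
  refine (hg.1.continuous.continuousWithinAt (s := Set.Ioi t)).congr_of_eventuallyEq ?_
    (h ⟨Int.floor_le t, Int.lt_floor_add_one t⟩)
  filter_upwards [Ioo_mem_nhdsGT (Int.lt_floor_add_one t)] with u hu
  exact h ⟨(Int.floor_le t).trans hu.1.le, hu.2⟩

/-- The right derivative exists at every point, also for two exponents (`L = []`), where the
two-sided derivative fails at the integers. -/
theorem hasDerivWithinAt_exp_mul_splineSeries (l₀ l : ℝ) (L : List ℝ) (a : ℤ → ℂ) (t : ℝ) :
    HasDerivWithinAt (fun t : ℝ => ((Real.exp (-(l * t)) : ℝ) : ℂ) * splineSeries l₀ (l :: L) a t)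
      ((Real.exp (-(l * t)) : ℝ) * splineSeries l₀ L (coeffDiff l a) t) (Set.Ioi t) t := by
  have hm : Measurable fun u : ℝ => ((Real.exp (-(l * u)) : ℝ) : ℂ) *
      splineSeries l₀ L (coeffDiff l a) u := by
    have := measurable_splineSeries l₀ L (coeffDiff l a)
    fun_prop
  have h := intervalIntegral.integral_hasDerivWithinAt_right (s := Set.Ici t) (t := Set.Ioi t)
    (intervalIntegrable_exp_mul_splineSeries l l₀ L (coeffDiff l a) 0 t)
    hm.aestronglyMeasurable.stronglyMeasurableAtFilter
    ((by fun_prop : ContinuousWithinAt (fun u : ℝ => ((Real.exp (-(l * u)) : ℝ) : ℂ))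
      (Set.Ioi t) t).mul (continuousWithinAt_splineSeries ..))
  have h := (h.mono Set.Ioi_subset_Ici_self).const_add
    ((Real.exp (-(l * 0)) : ℝ) * splineSeries l₀ (l :: L) a 0)
  simpa only [← exp_mul_splineSeries_cons] using h

theorem eqOn_zero_of_integral_eq_zero {j : ℤ} (h : ∀ s ∈ Set.Ioo (j : ℝ) (j + 1),
    ∫ u in (j : ℝ)..s, (Real.exp (-(l * u)) : ℝ) * splineSeries l₀ L a u = 0) :
    Set.EqOn (splineSeries l₀ L a) 0 (Set.Ioo (j : ℝ) (j + 1)) := by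
  obtain ⟨g, hg, hga⟩ := exists_eqOn_Ico l₀ L a j
  intro s hs
  have hgc := hg.1.continuous
  have hcont : Continuous fun u : ℝ => ((Real.exp (-(l * u)) : ℝ) : ℂ) * g u := by fun_prop
  have h1 := (hcont.integral_hasStrictDerivAt j s).hasDerivAt
  have h2 : (fun s => ∫ u in (j : ℝ)..s, ((Real.exp (-(l * u)) : ℝ) : ℂ) * g u) =ᶠ[nhds s]
      fun _ => 0 := by
    filter_upwards [Ioo_mem_nhds hs.1 hs.2] with r hr
    rw [← h r hr]
    refine intervalIntegral.integral_congr fun u hu => ?_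
    rw [Set.uIcc_of_le hr.1.le] at hu
    rw [hga ⟨hu.1, hu.2.trans_lt hr.2⟩]
  have h3 := (h1.congr_of_eventuallyEq h2.symm).unique (hasDerivAt_const s 0)
  rw [hga (Set.Ioo_subset_Ico_self hs)]
  simpa using h3

theorem coeffDiff_exp (l : ℝ) : coeffDiff l (fun j : ℤ => ((Real.exp (l * j) : ℝ) : ℂ)) = 0 := by
  ext j
  simp only [coeffDiff, Pi.zero_apply]
  rw [← ofReal_mul, ← Real.exp_add, sub_eq_zero]
  push_cast
  congr 1
  ring

/-- The coefficients `exp (l * j)` give a nonzero multiple of `exp (l * t)`: they are annihilated by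
`coeffDiff l`, and the series is positive. -/
theorem exists_splineSeries_exp (l₀ l : ℝ) (L : List ℝ) : ∃ K : ℂ, K ≠ 0 ∧ ∀ t : ℝ,
    (Real.exp (-(l * t)) : ℝ) *
      splineSeries l₀ (l :: L) (fun j : ℤ => ((Real.exp (l * j) : ℝ) : ℂ)) t = K := by
  refine ⟨splineSeries l₀ (l :: L) (fun j : ℤ => ((Real.exp (l * j) : ℝ) : ℂ)) 0, ?_, fun t => ?_⟩
  · have := splineSeries_re_pos (l₀ := l₀) (L := l :: L) (t := 0)
      (a := fun j : ℤ => ((Real.exp (l * j) : ℝ) : ℂ)) (fun j => by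
        rw [ofReal_re]; exact Real.exp_pos _)
    intro h
    rw [h] at this
    simp at this
  · rw [exp_mul_splineSeries_cons t 0, coeffDiff_exp]
    simp [splineSeries_zero]

/-- Local linear independence of the translates of the B-spline: a series that vanishes on one unit
interval has zero coefficients at all the translates that meet this interval. Applying `d/dt - l` and
induction make these coefficients a geometric progression with ratio `exp l`, so that the series is a
multiple of `exp (l * t)` there, and the multiple must be zero. -/
theorem coeff_eq_zero_of_eqOn {j : ℤ}
    (h : Set.EqOn (splineSeries l₀ L a) 0 (Set.Ioo (j : ℝ) (j + 1))) :
    ∀ i : ℤ, j - L.length ≤ i → i ≤ j → a i = 0 := by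
  induction L generalizing a with
  | nil =>
    intro i hi hi'
    obtain rfl : i = j := le_antisymm hi' (by simpa using hi)
    have hm : (i : ℝ) + 1 / 2 ∈ Set.Ioo (i : ℝ) (i + 1) := by constructor <;> linarith
    have hf : ⌊(i : ℝ) + 1 / 2⌋ = i := Int.floor_eq_iff.2 ⟨hm.1.le, hm.2⟩
    have := h hm
    rw [splineSeries_nil, hf, Pi.zero_apply, mul_eq_zero] at this
    exact this.resolve_right (by exact_mod_cast (Real.exp_pos _).ne')
  | cons l L ih =>
    have hcl : Set.EqOn (splineSeries l₀ (l :: L) a) 0 (Set.Icc (j : ℝ) (j + 1)) := by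
      have := h.closure (continuous_splineSeries_cons ..) continuous_const
      rwa [closure_Ioo (by linarith)] at this
    have h1 : Set.EqOn (splineSeries l₀ L (coeffDiff l a)) 0 (Set.Ioo (j : ℝ) (j + 1)) := by
      refine eqOn_zero_of_integral_eq_zero (l := l) fun s hs => ?_
      have := exp_mul_splineSeries_cons (l₀ := l₀) (l := l) (L := L) (a := a) s j
      rw [hcl (Set.Ioo_subset_Icc_self hs), hcl ⟨le_rfl, by linarith⟩] at this
      simpa using this.symm
    have h2 := ih h1
    -- the coefficients in the window form a geometric progression
    have h3 : ∀ n : ℕ, n ≤ L.length + 1 → a (j - n) =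
        a j * (Real.exp (-(l * j)) : ℝ) * (Real.exp (l * ((j - n : ℤ) : ℝ)) : ℝ) := by
      intro n
      induction n with
      | zero =>
        intro _
        rw [mul_assoc, ← ofReal_mul, ← Real.exp_add]
        simp
      | succ n ihn =>
        intro hn
        have h4 := h2 (j - n) (by omega) (by omega)
        rw [coeffDiff, sub_eq_zero, ihn (by omega), mul_left_comm, ← ofReal_mul,
          ← Real.exp_add] at h4
        rw [show j - ((n + 1 : ℕ) : ℤ) = j - n - 1 by push_cast; ring, ← h4]
        congr 3
        push_cast
        ring
    obtain ⟨K, hK, hKt⟩ := exists_splineSeries_exp l₀ l L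
    have h5 : a j * (Real.exp (-(l * j)) : ℝ) = 0 := by
      have h6 := hcl (x := j) ⟨le_rfl, by linarith⟩
      rw [splineSeries_congr (b := fun i => a j * (Real.exp (-(l * j)) : ℝ) *
        (Real.exp (l * i) : ℝ)), splineSeries_const_mul] at h6
      · refine (mul_eq_zero.1 h6).resolve_right fun h7 => hK ?_
        rw [← hKt j, h7, mul_zero]
      · intro i hi hi'
        rw [Int.floor_intCast, List.length_cons] at *
        have := h3 (j - i).toNat (by omega)
        rwa [show j - ((j - i).toNat : ℤ) = i by omega] at this
    intro i hi hi'
    rw [List.length_cons] at hi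
    have := h3 (j - i).toNat (by omega)
    rw [show j - ((j - i).toNat : ℤ) = i by omega] at this
    rw [this, h5, zero_mul]

end

/-! ### Cardinal splines as series with bounded coefficients -/

section

variable {l₀ l : ℝ} {L : List ℝ} {a b : ℤ → ℂ} {t s : ℝ} {f g : ℝ → ℂ} {Λ : Multiset ℝ}

theorem exists_sub_shift_eq (d : ℤ → ℂ) : ∃ c : ℤ → ℂ, ∀ j, c j - c (j - 1) = d j := by
  refine ⟨fun j => ∑ i ∈ Finset.Ioc 0 j, d i - ∑ i ∈ Finset.Ioc j 0, d i, fun j => ?_⟩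
  rcases le_or_gt j 0 with hj | hj
  · have h : Finset.Ioc (j - 1) 0 = insert j (Finset.Ioc j 0) := by ext; simp; omega
    simp [h, Finset.Ioc_eq_empty_of_le hj, Finset.Ioc_eq_empty_of_le (show j - 1 ≤ 0 by omega)]
  · have h : Finset.Ioc 0 j = insert j (Finset.Ioc 0 (j - 1)) := by ext; simp; omega
    simp [h, Finset.Ioc_eq_empty_of_le hj.le,
      Finset.Ioc_eq_empty_of_le (show 0 ≤ j - 1 by omega)]

theorem exists_coeffDiff_eq (l : ℝ) (b : ℤ → ℂ) : ∃ a, coeffDiff l a = b := by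
  obtain ⟨c, hc⟩ := exists_sub_shift_eq fun j => (Real.exp (-(l * (j - 1))) : ℝ) * b j
  refine ⟨fun j => (Real.exp (l * j) : ℝ) * c j, funext fun j => ?_⟩
  have h : ((Real.exp (-l) : ℝ) : ℂ) * (((Real.exp (l * j) : ℝ) : ℂ) * c j) =
      (Real.exp (l * (j - 1)) : ℝ) * c j := by
    rw [← mul_assoc, ← ofReal_mul, ← Real.exp_add]
    congr 3
    ring
  have h2 := exp_mul_exp_neg l ((j : ℝ) - 1) (b j)
  rw [← hc j] at h2
  simp only [coeffDiff]
  rw [h, ← h2, Int.cast_sub, Int.cast_one]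
  ring

/-- Smooth solutions on the unit intervals whose derivatives of order less than `L.length` match at
the integers come from one coefficient sequence. The induction applies `d/dt - l` to all pieces and
integrates the resulting series; the integration constant is absorbed by `exists_splineSeries_exp`. -/
theorem exists_eqOn_pieces (l₀ : ℝ) (L : List ℝ) (g : ℤ → ℝ → ℂ)
    (hg : ∀ j, g j ∈ solutionSpace (l₀ ::ₘ (L : Multiset ℝ)))
    (hm : ∀ i < L.length, ∀ j : ℤ, iteratedDeriv i (g (j - 1)) j = iteratedDeriv i (g j) j) :
    ∃ a, ∀ j : ℤ, Set.EqOn (g j) (splineSeries l₀ L a) (Set.Ico (j : ℝ) (j + 1)) := by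
  induction L generalizing g with
  | nil =>
    refine ⟨fun j => g j j * (Real.exp l₀ : ℝ), fun j t ht => ?_⟩
    obtain ⟨h1, h2⟩ := mem_solutionSpace_cons.1 (hg j)
    rw [Multiset.coe_nil, mem_solutionSpace_zero] at h2
    have h3 := exp_mul_eq_add_integral h1 l₀ t j
    have h4 : ∀ u, deriv (g j) u - l₀ * g j u = 0 := fun u => congrFun h2 u
    simp only [h4, mul_zero, intervalIntegral.integral_zero, add_zero] at h3
    have h5 : ((Real.exp (l₀ * t) : ℝ) : ℂ) * (Real.exp (-(l₀ * j)) : ℝ) =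
        (Real.exp l₀ : ℝ) * (Real.exp (l₀ * (Int.fract t - 1)) : ℝ) := by
      rw [Int.fract, Int.floor_eq_iff.2 ⟨ht.1, ht.2⟩]
      simp only [← ofReal_mul, ← Real.exp_add]
      congr 2
      ring
    rw [splineSeries_nil, Int.floor_eq_iff.2 ⟨ht.1, ht.2⟩, ← exp_mul_exp_neg l₀ t (g j t), h3]
    linear_combination g j j * h5
  | cons l L ih =>
    have hg' : ∀ j, ContDiff ℝ ∞ (g j) ∧
        (fun t => deriv (g j) t - l * g j t) ∈ solutionSpace (l₀ ::ₘ (L : Multiset ℝ)) := by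
      intro j
      have := hg j
      rwa [← Multiset.cons_coe, Multiset.cons_swap, mem_solutionSpace_cons] at this
    obtain ⟨b, hb⟩ := ih (fun j t => deriv (g j) t - l * g j t) (fun j => (hg' j).2) (by
      intro i hi j
      rw [iteratedDeriv_deriv_sub_mul (hg' _).1, iteratedDeriv_deriv_sub_mul (hg' _).1,
        hm (i + 1) (by simpa using hi), hm i (by simp; omega)])
    obtain ⟨a₀, rfl⟩ := exists_coeffDiff_eq l b
    set D : ℤ → ℝ → ℂ := fun j t =>
      (Real.exp (-(l * t)) : ℝ) * g j t - (Real.exp (-(l * t)) : ℝ) * splineSeries l₀ (l :: L) a₀ t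
      with hD
    -- `D j` is constant on the closed interval, and continuity of the spline links neighbours
    have h1 : ∀ (j : ℤ), ∀ t ∈ Set.Icc (j : ℝ) (j + 1), D j t = D j j := by
      intro j t ht
      simp only [hD]
      rw [exp_mul_eq_add_integral (hg' j).1 l t j, exp_mul_splineSeries_cons t j,
        intervalIntegral.integral_congr_ae (g := fun u => ((Real.exp (-(l * u)) : ℝ) : ℂ) *
          splineSeries l₀ L (coeffDiff l a₀) u)]
      · ring
      · have : ∀ᵐ u : ℝ, u ≠ j + 1 := by simp [ae_iff]
        filter_upwards [this] with u hu hu'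
        rw [Set.uIoc_of_le ht.1] at hu'
        rw [← hb j ⟨hu'.1.le, lt_of_le_of_ne (hu'.2.trans ht.2) hu⟩]
    have h2 : ∀ j : ℤ, D (j - 1) (j - 1 : ℤ) = D j j := by
      intro j
      rw [← h1 (j - 1) j (by push_cast; constructor <;> linarith)]
      simp only [hD]
      have := hm 0 (by simp) j
      simp only [iteratedDeriv_zero] at this
      rw [this]
    have h3 : ∀ j : ℤ, D j j = D 0 (0 : ℤ) := by
      intro j
      induction j using Int.induction_on with
      | zero => rfl
      | succ i hi =>
        have := h2 (i + 1)
        rw [add_sub_cancel_right] at this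
        rw [← this, hi]
      | pred i hi => rw [h2 (-i), hi]
    obtain ⟨K, hK, hKt⟩ := exists_splineSeries_exp l₀ l L
    refine ⟨fun j => a₀ j + D 0 (0 : ℤ) / K * (Real.exp (l * j) : ℝ), fun j t ht => ?_⟩
    rw [splineSeries_add, splineSeries_const_mul]
    have h4 := (h1 j t (Set.Ico_subset_Icc_self ht)).trans (h3 j)
    have h5 : ((Real.exp (-(l * t)) : ℝ) : ℂ) ≠ 0 := by exact_mod_cast (Real.exp_pos _).ne'
    apply mul_left_cancel₀ h5
    rw [mul_add, mul_left_comm, hKt, div_mul_cancel₀ _ hK, ← h4]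
    simp only [hD]
    ring

/-- Every cardinal exponential spline is a series of translates of the B-spline. -/
theorem exists_eq_splineSeries
    (hf : f ∈ cardinalSplines (l₀ ::ₘ ((l :: L : List ℝ) : Multiset ℝ))) :
    ∃ a, f = splineSeries l₀ (l :: L) a := by
  obtain ⟨hc, -, hp⟩ := hf
  choose g hg hfg using hp
  have hcl : ∀ i < (l :: L).length, ∀ j : ℤ,
      Set.EqOn (iteratedDeriv i f) (iteratedDeriv i (g j)) (Set.Icc (j : ℝ) (j + 1)) := by
    intro i hi j
    have h1 : Set.EqOn (iteratedDeriv i f) (iteratedDeriv i (g j)) (Set.Ioo (j : ℝ) (j + 1)) :=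
      (hfg j).iteratedDeriv_of_isOpen isOpen_Ioo i
    have h2 : Continuous (iteratedDeriv i f) := by
      refine ContDiff.continuous_iteratedDeriv _ hc ?_
      simp only [List.length_cons] at hi
      simp only [Multiset.card_cons, Multiset.coe_card, List.length_cons]
      exact_mod_cast (by omega : i ≤ L.length + 1 + 1 - 2)
    have h3 : Continuous (iteratedDeriv i (g j)) :=
      ContDiff.continuous_iteratedDeriv _ (hg j).1 (by exact_mod_cast le_top)
    have := h1.closure h2 h3
    rwa [closure_Ioo (by linarith)] at this
  obtain ⟨a, ha⟩ := exists_eqOn_pieces l₀ (l :: L) g hg (by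
    intro i hi j
    rw [← hcl i hi (j - 1) (by push_cast; constructor <;> linarith),
      ← hcl i hi j ⟨le_rfl, by linarith⟩])
  refine ⟨a, funext fun t => ?_⟩
  have ht : t ∈ Set.Ico (⌊t⌋ : ℝ) (⌊t⌋ + 1) := ⟨Int.floor_le t, Int.lt_floor_add_one t⟩
  rw [← ha ⌊t⌋ ht]
  simpa using hcl 0 (by simp) ⌊t⌋ (Set.Ico_subset_Icc_self ht)

/-- The coefficients of a square-integrable spline are bounded. The finitely many coefficients that
matter on `(0, 1)` are mapped linearly to `L²(0, 1)`; the map is injective by local linear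
independence, hence bounded below, and translation by integers gives a uniform estimate. -/
theorem exists_norm_coeff_le (hf : MemLp (splineSeries l₀ (l :: L) a) 2 volume) :
    ∃ M, ∀ j, ‖a j‖ ≤ M := by
  set μ : Measure ℝ := volume.restrict (Set.Ioo 0 1) with hμ
  set W : Finset ℤ := Finset.Icc (-((l :: L).length : ℤ)) 0 with hW
  set ext : (W → ℂ) → ℤ → ℂ := fun v i => if h : i ∈ W then v ⟨i, h⟩ else 0 with hext
  have hmem : ∀ a, MemLp (splineSeries l₀ (l :: L) a) 2 μ := by
    intro a
    obtain ⟨M, hM⟩ := exists_norm_splineSeries_le_on_Icc l₀ (l :: L) a 0 1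
    refine MemLp.of_bound (continuous_splineSeries_cons ..).aestronglyMeasurable M ?_
    exact (ae_restrict_iff' measurableSet_Ioo).2
      (ae_of_all _ fun t ht => hM t (Set.Ioo_subset_Icc_self ht))
  -- from the coefficients with indices in `W` to the restriction of the spline to `(0, 1)`
  let Φ : (W → ℂ) →ₗ[ℂ] Lp ℂ 2 μ :=
    { toFun := fun v => (hmem (ext v)).toLp
      map_add' := fun v w => by
        rw [← MemLp.toLp_add]
        refine MemLp.toLp_congr _ _ (ae_of_all _ fun t => ?_)
        rw [Pi.add_apply, ← splineSeries_add]
        congr 1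
        ext i
        simp only [hext, Pi.add_apply]
        split_ifs <;> simp
      map_smul' := fun c v => by
        rw [RingHom.id_apply, ← MemLp.toLp_const_smul]
        refine MemLp.toLp_congr _ _ (ae_of_all _ fun t => ?_)
        rw [Pi.smul_apply, smul_eq_mul, ← splineSeries_const_mul]
        congr 1
        ext i
        simp only [hext, Pi.smul_apply]
        split_ifs <;> simp }
  have hΦ : LinearMap.ker Φ = ⊥ := by
    rw [LinearMap.ker_eq_bot']
    intro v hv
    have h1 : splineSeries l₀ (l :: L) (ext v) =ᵐ[μ] 0 := (MemLp.toLp_eq_toLp_iff (hmem _)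
      (MemLp.zero' : MemLp (fun _ => (0 : ℂ)) 2 μ)).1 hv
    have h2 := Measure.eqOn_open_of_ae_eq h1 isOpen_Ioo
      (continuous_splineSeries_cons ..).continuousOn continuousOn_const
    ext ⟨i, hi⟩
    have hi' := Finset.mem_Icc.1 hi
    have := coeff_eq_zero_of_eqOn (j := 0) (by simpa using h2) i (by simpa using hi'.1) hi'.2
    simpa [hext, hi] using this
  obtain ⟨K, hK, hKΦ⟩ := Φ.exists_antilipschitzWith hΦ
  refine ⟨K * (eLpNorm (splineSeries l₀ (l :: L) a) 2 volume).toReal, fun j => ?_⟩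
  set v : W → ℂ := fun i => a (i + j) with hv
  have h0 : (0 : ℤ) ∈ W := by simp [hW]
  have h1 : ‖a j‖ ≤ ‖v‖ := by
    have := norm_le_pi_norm v ⟨0, h0⟩
    simpa [hv] using this
  have h2 : ‖v‖ ≤ K * ‖Φ v‖ := by
    have := hKΦ.le_mul_dist v 0
    simpa using this
  refine h1.trans (h2.trans ?_)
  gcongr
  change ‖(hmem (ext v)).toLp‖ ≤ _
  rw [Lp.norm_toLp]
  refine ENNReal.toReal_mono hf.2.ne ?_
  have h3 : eLpNorm (splineSeries l₀ (l :: L) (ext v)) 2 μ =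
      eLpNorm (splineSeries l₀ (l :: L) a ∘ fun t : ℝ => t + j) 2 μ := by
    refine eLpNorm_congr_ae ((ae_restrict_iff' measurableSet_Ioo).2 (ae_of_all _ fun t ht => ?_))
    have hfl : ⌊t⌋ = 0 := Int.floor_eq_iff.2 ⟨by simpa using ht.1.le, by simpa using ht.2⟩
    rw [Function.comp_apply, splineSeries_add_int]
    refine splineSeries_congr fun i hi hi' => ?_
    have : i ∈ W := Finset.mem_Icc.2 ⟨by omega, by omega⟩
    simp [hext, this, hv]
  rw [h3]
  refine (eLpNorm_mono_measure _ Measure.restrict_le_self).trans ?_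
  rw [eLpNorm_comp_measurePreserving hf.1 (measurePreserving_add_right volume (j : ℝ))]

end

/-! ### The B-spline and its Fourier transform -/

section

variable {l₀ l : ℝ} {L : List ℝ} {a b : ℤ → ℂ} {t s : ℝ} {f g : ℝ → ℂ} {Λ : Multiset ℝ}

/-- The B-spline with exponents `l₀` and the entries of `L`, supported in `[0, L.length + 1]`. -/
def bSpline (l₀ : ℝ) (L : List ℝ) : ℝ → ℂ := splineSeries l₀ L (Pi.single 0 1)

theorem bSpline_sub_int (j : ℤ) :
    bSpline l₀ L (t - j) = splineSeries l₀ L (Pi.single j 1) t := by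
  have h := splineSeries_add_int (l₀ := l₀) (L := L) (a := Pi.single 0 1) (t := t) (-j)
  rw [Int.cast_neg, ← sub_eq_add_neg] at h
  rw [bSpline, h]
  congr 1
  ext i
  simp only [Pi.single_apply, ← sub_eq_add_neg, sub_eq_zero]

theorem splineSeries_sum {ι : Type*} (W : Finset ι) (c : ι → ℂ) (A : ι → ℤ → ℂ) :
    splineSeries l₀ L (fun j => ∑ r ∈ W, c r * A r j) t =
      ∑ r ∈ W, c r * splineSeries l₀ L (A r) t := by
  classical
  induction W using Finset.induction_on with
  | empty =>
    simp only [Finset.sum_empty]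
    exact splineSeries_zero
  | insert r W hr ih =>
    simp only [Finset.sum_insert hr, ← ih]
    rw [splineSeries_add, splineSeries_const_mul]

theorem bSpline_sub_int_eq_zero {j : ℤ} (h : j ∉ Finset.Icc (⌊t⌋ - L.length) ⌊t⌋) :
    bSpline l₀ L (t - j) = 0 := by
  rw [bSpline_sub_int]
  refine splineSeries_eq_zero fun i hi hi' => ?_
  rw [Pi.single_apply, if_neg]
  rintro rfl
  exact h (Finset.mem_Icc.2 ⟨hi, hi'⟩)

theorem splineSeries_eq_sum {W : Finset ℤ} (hW : Finset.Icc (⌊t⌋ - L.length) ⌊t⌋ ⊆ W) :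
    splineSeries l₀ L a t = ∑ j ∈ W, a j * bSpline l₀ L (t - j) := by
  simp only [bSpline_sub_int]
  rw [← splineSeries_sum]
  refine splineSeries_congr fun j hj hj' => ?_
  have : j ∈ W := hW (Finset.mem_Icc.2 ⟨hj, hj'⟩)
  simp [Pi.single_apply, this]

/-- The sum has finitely many nonzero terms for each `t`. -/
theorem hasSum_splineSeries (l₀ : ℝ) (L : List ℝ) (a : ℤ → ℂ) (t : ℝ) :
    HasSum (fun j : ℤ => a j * bSpline l₀ L (t - j)) (splineSeries l₀ L a t) := by
  rw [splineSeries_eq_sum subset_rfl]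
  refine hasSum_sum_of_ne_finset_zero fun j hj => ?_
  rw [bSpline_sub_int_eq_zero hj, mul_zero]

theorem bSpline_eq_zero (h : t ∉ Set.Icc (0 : ℝ) (L.length + 1)) : bSpline l₀ L t = 0 := by
  have := bSpline_sub_int_eq_zero (l₀ := l₀) (L := L) (t := t) (j := 0)
  rw [Int.cast_zero, sub_zero] at this
  refine this fun h' => h ?_
  rw [Finset.mem_Icc] at h'
  refine ⟨by simpa using Int.floor_nonneg.1 h'.2, ?_⟩
  have h1 := Int.lt_floor_add_one t
  have h2 : (⌊t⌋ : ℝ) ≤ L.length := by exact_mod_cast (by omega : ⌊t⌋ ≤ L.length)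
  linarith

theorem exists_norm_bSpline_le (l₀ : ℝ) (L : List ℝ) : ∃ C, 0 ≤ C ∧ ∀ t, ‖bSpline l₀ L t‖ ≤ C := by
  obtain ⟨C, hC, h⟩ := exists_norm_splineSeries_le l₀ L
  refine ⟨C * 1, by simpa, fun t => h _ _ (fun j => ?_) t⟩
  rw [Pi.single_apply]
  split_ifs <;> simp

theorem integrable_bSpline (l₀ : ℝ) (L : List ℝ) : Integrable (bSpline l₀ L) := by
  obtain ⟨C, hC, h⟩ := exists_norm_bSpline_le l₀ L
  have h1 : IntegrableOn (bSpline l₀ L) (Set.Icc 0 (L.length + 1)) :=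
    Measure.integrableOn_of_bounded (M := C) (by simp)
      (measurable_splineSeries _ _ _).aestronglyMeasurable (ae_of_all _ h)
  exact h1.integrable_of_forall_notMem_eq_zero fun t ht => bSpline_eq_zero ht

/-- The B-spline with one exponent `l`, up to its values at the end points of its support. -/
def expBox (l t : ℝ) : ℂ :=
  Set.indicator (Set.Ioc (0 : ℝ) 1) (fun t : ℝ => ((Real.exp (l * (t - 1)) : ℝ) : ℂ)) t

theorem integrable_expBox (l : ℝ) : Integrable (expBox l) := by
  have : IntegrableOn (fun t : ℝ => ((Real.exp (l * (t - 1)) : ℝ) : ℂ)) (Set.Ioc 0 1) :=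
    (Continuous.integrableOn_Icc (by fun_prop)).mono_set Set.Ioc_subset_Icc_self
  exact this.integrable_indicator measurableSet_Ioc

theorem bSpline_nil_ae_eq (l₀ : ℝ) : bSpline l₀ [] =ᵐ[volume] expBox l₀ := by
  have h : ∀ x : ℝ, ∀ᵐ t : ℝ, t ≠ x := fun x => by simp [ae_iff]
  filter_upwards [h 0, h 1] with t h0 h1
  rw [bSpline, splineSeries_nil, expBox]
  by_cases ht : t ∈ Set.Ioc (0 : ℝ) 1
  · have hf : ⌊t⌋ = 0 := by
      rw [Int.floor_eq_zero_iff]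
      exact ⟨ht.1.le, lt_of_le_of_ne ht.2 h1⟩
    rw [Set.indicator_of_mem ht, Int.fract, hf]
    simp
  · have hf : ⌊t⌋ ≠ 0 := by
      rw [Ne, Int.floor_eq_zero_iff]
      exact fun h' => ht ⟨lt_of_le_of_ne h'.1 (Ne.symm h0), h'.2.le⟩
    rw [Set.indicator_of_notMem ht]
    simp [hf]

theorem bSpline_cons_eq_convolution (l₀ l : ℝ) (L : List ℝ) :
    bSpline l₀ (l :: L) = convolution (expBox l) (bSpline l₀ L) (ContinuousLinearMap.mul ℂ ℂ)
      volume := by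
  ext t
  rw [convolution_def, bSpline, splineSeries_cons]
  simp only [ContinuousLinearMap.mul_apply', expBox]
  have h : ∀ u : ℝ, (Set.indicator (Set.Ioc (0 : ℝ) 1)
      (fun t : ℝ => ((Real.exp (l * (t - 1)) : ℝ) : ℂ)) u) * bSpline l₀ L (t - u) =
      Set.indicator (Set.Ioc (0 : ℝ) 1) (fun u : ℝ => ((Real.exp (l * (t - 1)) : ℝ) : ℂ) *
        (((Real.exp (-(l * (t - u))) : ℝ) : ℂ) * bSpline l₀ L (t - u))) u := by
    intro u
    by_cases hu : u ∈ Set.Ioc (0 : ℝ) 1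
    · rw [Set.indicator_of_mem hu, Set.indicator_of_mem hu, ← mul_assoc, ← ofReal_mul,
        ← Real.exp_add]
      congr 3
      ring
    · rw [Set.indicator_of_notMem hu, Set.indicator_of_notMem hu, zero_mul]
  simp_rw [h]
  rw [integral_indicator measurableSet_Ioc, ← intervalIntegral.integral_of_le zero_le_one,
    intervalIntegral.integral_const_mul,
    intervalIntegral.integral_comp_sub_left (fun s => ((Real.exp (-(l * s)) : ℝ) : ℂ) *
      bSpline l₀ L s) t, sub_zero]
  rfl

theorem fourierHat_bSpline (l₀ : ℝ) (L : List ℝ) (ξ : ℝ) : fourierHat (bSpline l₀ L) ξ =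
    ((l₀ :: L).map fun l => fourierHat (expBox l) ξ).prod := by
  induction L with
  | nil =>
    simp only [List.map_cons, List.map_nil, List.prod_cons, List.prod_nil, mul_one, fourierHat]
    refine integral_congr_ae ?_
    filter_upwards [bSpline_nil_ae_eq l₀] with t ht
    rw [ht]
  | cons l L ih =>
    have : fourierHat (bSpline l₀ (l :: L)) ξ =
        fourierHat (expBox l) ξ * fourierHat (bSpline l₀ L) ξ := by
      rw [fourierHat_eq, fourierHat_eq, fourierHat_eq, bSpline_cons_eq_convolution]
      exact Real.fourier_mul_convolution_eq (integrable_expBox l) (integrable_bSpline l₀ L) _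
    rw [this, ih]
    simp only [List.map_cons, List.prod_cons]
    ring

theorem fourierHat_expBox (l ξ : ℝ) : (I * ξ - l) * fourierHat (expBox l) ξ =
    exp (-(l : ℂ)) - exp (-(I * ξ)) := by
  have h : fourierHat (expBox l) ξ = ∫ t in (0 : ℝ)..1, exp (-(l : ℂ)) * exp ((l - I * ξ) * t) := by
    rw [intervalIntegral.integral_of_le zero_le_one, ← integral_indicator measurableSet_Ioc]
    refine integral_congr_ae (ae_of_all _ fun t => ?_)
    simp only [expBox]
    by_cases ht : t ∈ Set.Ioc (0 : ℝ) 1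
    · rw [Set.indicator_of_mem ht, Set.indicator_of_mem ht, ofReal_exp, ← exp_add, ← exp_add]
      congr 1
      push_cast
      ring
    · rw [Set.indicator_of_notMem ht, Set.indicator_of_notMem ht, mul_zero]
  rw [h, intervalIntegral.integral_const_mul]
  by_cases hc : (l : ℂ) - I * ξ = 0
  · rw [show I * (ξ : ℂ) - l = 0 by rw [← neg_sub, hc, neg_zero],
      show I * (ξ : ℂ) = l by rw [sub_eq_zero] at hc; exact hc.symm]
    simp
  · rw [integral_exp_mul_complex hc, mul_left_comm, ← neg_sub (l : ℂ), neg_mul,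
      mul_div_cancel₀ _ hc]
    rw [mul_neg, mul_sub, ← exp_add, ← exp_add]
    simp only [ofReal_one, mul_one, ofReal_zero, mul_zero, add_zero, neg_sub]
    congr 2
    ring

theorem exists_norm_fourierHat_expBox_le (l : ℝ) :
    ∃ C, 0 ≤ C ∧ ∀ ξ, ‖fourierHat (expBox l) ξ‖ ≤ C * (1 + |ξ|)⁻¹ := by
  refine ⟨(∫ t, ‖expBox l t‖) + (Real.exp (-l) + 1), by positivity, fun ξ => ?_⟩
  rw [← div_eq_mul_inv, le_div_iff₀ (by positivity), mul_add, mul_one]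
  have hexp : ∀ x : ℝ, ‖exp (-(I * x))‖ = 1 := fun x => by
    rw [show -(I * (x : ℂ)) = ((-x : ℝ) : ℂ) * I by push_cast; ring, norm_exp_ofReal_mul_I]
  gcongr
  · refine (norm_integral_le_integral_norm _).trans (le_of_eq ?_)
    congr 1
    ext t
    rw [norm_mul, mul_assoc, ← ofReal_mul, hexp, one_mul]
  · have h1 : |ξ| ≤ ‖I * (ξ : ℂ) - l‖ := by
      simpa using abs_im_le_norm (I * (ξ : ℂ) - l)
    calc ‖fourierHat (expBox l) ξ‖ * |ξ| ≤ ‖fourierHat (expBox l) ξ‖ * ‖I * (ξ : ℂ) - l‖ := by gcongr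
      _ = ‖exp (-(l : ℂ)) - exp (-(I * ξ))‖ := by rw [← fourierHat_expBox, norm_mul, mul_comm]
      _ ≤ ‖exp (-(l : ℂ))‖ + ‖exp (-(I * ξ))‖ := norm_sub_le _ _
      _ = Real.exp (-l) + 1 := by rw [hexp, norm_exp]; simp

theorem continuous_fourierHat (hf : Integrable f) : Continuous (fourierHat f) := by
  have h : Continuous (𝓕 f) := by
    exact VectorFourier.fourierIntegral_continuous Real.continuous_fourierChar
      (by fun_prop) hf
  rw [funext (fourierHat_eq f)]
  exact h.comp (by fun_prop)

theorem integrable_fourierHat_bSpline (l₀ l : ℝ) (L : List ℝ) :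
    Integrable (fourierHat (bSpline l₀ (l :: L))) := by
  have hb : ∀ L : List ℝ, ∃ C, 0 ≤ C ∧
      ∀ ξ, ‖(L.map fun l => fourierHat (expBox l) ξ).prod‖ ≤ C := by
    intro L
    induction L with
    | nil => exact ⟨1, zero_le_one, by simp⟩
    | cons l L ih =>
      obtain ⟨C, hC, h⟩ := ih
      obtain ⟨D, hD, h'⟩ := exists_norm_fourierHat_expBox_le l
      refine ⟨D * C, by positivity, fun ξ => ?_⟩
      rw [List.map_cons, List.prod_cons, norm_mul]
      gcongr
      · refine (h' ξ).trans (mul_le_of_le_one_right hD (inv_le_one_of_one_le₀ ?_))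
        linarith [abs_nonneg ξ]
      · exact h ξ
  obtain ⟨C, hC, h⟩ := hb L
  obtain ⟨D₀, hD₀, h₀⟩ := exists_norm_fourierHat_expBox_le l₀
  obtain ⟨D, hD, h'⟩ := exists_norm_fourierHat_expBox_le l
  have hi : Integrable fun ξ : ℝ => D₀ * D * C * (1 + ‖ξ‖) ^ (-2 : ℝ) :=
    (integrable_one_add_norm (by simp)).const_mul _
  refine hi.mono' (continuous_fourierHat (integrable_bSpline _ _)).aestronglyMeasurable
    (ae_of_all _ fun ξ => ?_)
  rw [fourierHat_bSpline, List.map_cons, List.map_cons, List.prod_cons, List.prod_cons, norm_mul,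
    norm_mul, Real.rpow_neg (by positivity), Real.norm_eq_abs, Real.rpow_ofNat]
  calc _ ≤ D₀ * (1 + |ξ|)⁻¹ * (D * (1 + |ξ|)⁻¹ * C) := by
        gcongr
        · exact h₀ ξ
        · exact h' ξ
        · exact h ξ
    _ = _ := by
      field_simp

/-- Fourier inversion in the normalization of `fourierHat`. -/
theorem fourierHatInv_fourierHat (hc : Continuous f) (hf : Integrable f)
    (hF : Integrable (fourierHat f)) : fourierHatInv (fourierHat f) = f := by
  have h1 : 𝓕 f = fun v => fourierHat f (2 * Real.pi * v) := by
    ext v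
    rw [fourierHat_eq]
    field_simp
  have h2 : Integrable (𝓕 f) := by
    rw [h1]
    exact hF.comp_mul_left' (by positivity)
  conv_rhs => rw [← hc.fourierInv_fourier_eq hf h2]
  ext t
  rw [Real.fourierInv_eq', h1, fourierHatInv]
  have h3 := Measure.integral_comp_mul_left (fun ξ : ℝ => exp (I * ξ * t) * fourierHat f ξ)
    (2 * Real.pi)
  rw [abs_of_pos (show 0 < (2 * Real.pi)⁻¹ by positivity)] at h3
  simp only [smul_eq_mul]
  convert h3.symm using 1
  · simp
  · congr 1
    ext v
    congr 2
    simp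
    ring

theorem fourierHat_bSpline_of_ne_zero (l₀ : ℝ) (L : List ℝ) {ξ : ℝ} (hξ : ξ ≠ 0) :
    tbSplineHat (l₀ ::ₘ (L : Multiset ℝ)) ξ = fourierHat (bSpline l₀ L) ξ := by
  rw [fourierHat_bSpline, tbSplineHat, ← Multiset.prod_map_div, Multiset.cons_coe,
    Multiset.map_coe, Multiset.prod_coe]
  congr 2
  ext l
  rw [← fourierHat_expBox, mul_div_cancel_left₀]
  intro h
  have := congrArg im h
  simp at this
  exact hξ this

/-- The TB-spline, which is defined by its Fourier transform, is the B-spline. -/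
theorem tbSpline_eq_bSpline (l₀ l : ℝ) (L : List ℝ) :
    tbSpline (l₀ ::ₘ ((l :: L : List ℝ) : Multiset ℝ)) = bSpline l₀ (l :: L) := by
  rw [← fourierHatInv_fourierHat (f := bSpline l₀ (l :: L)) (continuous_splineSeries_cons ..)
    (integrable_bSpline ..) (integrable_fourierHat_bSpline ..)]
  ext t
  rw [tbSpline, fourierHatInv, fourierHatInv]
  congr 1
  refine integral_congr_ae ?_
  have h : ∀ᵐ ξ : ℝ, ξ ≠ 0 := by simp [ae_iff]
  filter_upwards [h] with ξ hξ
  rw [fourierHat_bSpline_of_ne_zero _ _ hξ]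

/-- `φ*(ξ)` is the value at `0` of the series with coefficients `exp (I * ξ) ^ j`, the exponential
Euler spline. -/
theorem phiStar_eq (l₀ l : ℝ) (L : List ℝ) (ξ : ℝ) :
    phiStar (l₀ ::ₘ ((l :: L : List ℝ) : Multiset ℝ)) ξ =
      splineSeries l₀ (l :: L) (fun j => exp (I * ξ) ^ j) 0 := by
  rw [phiStar, tbSpline_eq_bSpline]
  have h := (hasSum_splineSeries l₀ (l :: L) (fun j => exp (I * ξ) ^ j) 0)
  -- `phiStar` sums over `φ(j)`, while the series evaluates `B` at `0 - j`
  rw [← (Equiv.neg ℤ).hasSum_iff] at h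
  rw [← h.tsum_eq]
  congr 1
  ext j
  simp only [Function.comp_apply, Equiv.neg_apply, zpow_neg, Int.cast_neg, zero_sub, neg_neg]
  rw [mul_comm, ← exp_int_mul, ← exp_neg]
  congr 2
  ring

/-- The order of the exponents is irrelevant, since `tbSpline` depends on their multiset only. -/
theorem splineSeries_perm {l₀ l l₀' l' : ℝ} {L L' : List ℝ}
    (h : (l₀ :: l :: L).Perm (l₀' :: l' :: L')) (a : ℤ → ℂ) (t : ℝ) :
    splineSeries l₀ (l :: L) a t = splineSeries l₀' (l' :: L') a t := by
  have hB : bSpline l₀ (l :: L) = bSpline l₀' (l' :: L') := by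
    rw [← tbSpline_eq_bSpline, ← tbSpline_eq_bSpline, Multiset.cons_coe, Multiset.cons_coe,
      Multiset.coe_eq_coe.2 h]
  have h1 := hasSum_splineSeries l₀ (l :: L) a t
  rw [hB] at h1
  exact h1.unique (hasSum_splineSeries ..)

end

/-! ### The exponential Euler spline on the unit circle -/

section

variable {l₀ l : ℝ} {L : List ℝ} {a b : ℤ → ℂ} {t s : ℝ} {f g : ℝ → ℂ} {Λ : Multiset ℝ} {w : ℂ}

open scoped ComplexConjugate

/-- A pointwise inequality for `Im (conj (f u) * f v)` can be integrated in `u` and in `v`. -/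
theorem cross_integral_nonneg (hi : ∀ x y, IntervalIntegrable f volume x y) {κ x y p q : ℝ}
    (hxy : x ≤ y) (hpq : p ≤ q)
    (h : ∀ u ∈ Set.Icc x y, ∀ v ∈ Set.Icc p q, 0 ≤ κ * (conj (f u) * f v).im) :
    0 ≤ κ * (conj (∫ u in x..y, f u) * ∫ v in p..q, f v).im := by
  have him : ∀ (z : ℂ) (x y : ℝ), x ≤ y → (∀ u ∈ Set.Icc x y, 0 ≤ κ * (z * f u).im) →
      0 ≤ κ * (z * ∫ u in x..y, f u).im := by
    intro z x y hxy hz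
    have h1 := imCLM.intervalIntegral_comp_comm ((hi x y).const_mul z)
    simp only [imCLM_apply] at h1
    rw [← intervalIntegral.integral_const_mul, ← h1, ← intervalIntegral.integral_const_mul]
    exact intervalIntegral.integral_nonneg hxy hz
  have h2 : 0 ≤ κ * (-conj (∫ v in p..q, f v) * ∫ u in x..y, f u).im := by
    refine him _ x y hxy fun u hu => ?_
    have h3 := him (conj (f u)) p q hpq (h u hu)
    convert h3 using 2
    simp
    ring
  convert h2 using 2
  simp
  ring

/-- Two overlapping windows of length one, cut at each other's end points. -/
theorem window_integral_split (hi : ∀ x y, IntervalIntegrable f volume x y)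
    (hf : ∀ u, f (u + 1) = w * f u) (s t : ℝ) :
    (∫ u in (t - 1)..t, f u = (∫ u in (t - 1)..(s - 1), f u) + ∫ u in (s - 1)..t, f u) ∧
    (∫ u in t..s, f u = w * ∫ u in (t - 1)..(s - 1), f u) ∧
    (∫ u in (s - 1)..s, f u = (∫ u in (s - 1)..t, f u) + ∫ u in t..s, f u) := by
  refine ⟨(intervalIntegral.integral_add_adjacent_intervals (hi _ _) (hi _ _)).symm, ?_,
    (intervalIntegral.integral_add_adjacent_intervals (hi _ _) (hi _ _)).symm⟩
  rw [← intervalIntegral.integral_const_mul]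
  simp_rw [← hf]
  rw [intervalIntegral.integral_comp_add_right]
  simp

/-- Let `f (u + 1) = w * f u` with `w` not real. The property that `Im (conj (f u) * f v)` has the
sign of `Im w` whenever `u ≤ v ≤ u + 1` passes from `f` to the integrals of `f` over windows of length
one. With `α` and `β` the integrals over `[t - 1, s - 1]` and `[s - 1, t]`, the two windows give
`α + β` and `β + w * α`, and
`Im (conj (α + β) * (β + w * α)) = Im (conj α * β) + Im w * |α|² + Im (conj β * (w * α))`. -/
theorem cross_window_integral_nonneg (hi : ∀ x y, IntervalIntegrable f volume x y)
    (hf : ∀ u, f (u + 1) = w * f u) {κ : ℝ} (hκ : 0 < κ * w.im)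
    (h : ∀ u v, u ≤ v → v ≤ u + 1 → 0 ≤ κ * (conj (f u) * f v).im) {s t : ℝ} (hts : t ≤ s)
    (hst : s ≤ t + 1) :
    0 ≤ κ * (conj (∫ u in (t - 1)..t, f u) * ∫ u in (s - 1)..s, f u).im := by
  obtain ⟨h1, h2, h3⟩ := window_integral_split hi hf s t
  have hab := cross_integral_nonneg hi (κ := κ) (show t - 1 ≤ s - 1 by linarith)
    (show s - 1 ≤ t by linarith) fun u hu v hv => h u v (by linarith [hu.2, hv.1])
      (by linarith [hu.1, hv.2])
  have hba := cross_integral_nonneg hi (κ := κ) (show s - 1 ≤ t by linarith) hts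
    fun u hu v hv => h u v (by linarith [hu.2, hv.1]) (by linarith [hu.1, hv.2])
  rw [h1, h3]
  rw [h2] at hba ⊢
  set α := ∫ u in (t - 1)..(s - 1), f u
  set β := ∫ u in (s - 1)..t, f u
  have h4 : κ * (conj (α + β) * (β + w * α)).im = κ * (conj α * β).im +
      κ * w.im * normSq α + κ * (conj β * (w * α)).im := by
    simp [normSq_apply]
    ring
  rw [h4]
  have := mul_nonneg hκ.le (normSq_nonneg α)
  linarith

/-- The case of equality: if a window integral vanishes, then `β = -α` in the notation of
`cross_window_integral_nonneg`, and the last term there is `-Im w * |α|²`, which forces `α = 0`. -/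
theorem integral_eq_zero_of_window_integral_eq_zero
    (hi : ∀ x y, IntervalIntegrable f volume x y)
    (hf : ∀ u, f (u + 1) = w * f u) {κ : ℝ} (hκ : 0 < κ * w.im)
    (h : ∀ u v, u ≤ v → v ≤ u + 1 → 0 ≤ κ * (conj (f u) * f v).im) {s t : ℝ}
    (hA : ∫ u in (t - 1)..t, f u = 0) (hts : t ≤ s) (hst : s ≤ t + 1) :
    ∫ u in (t - 1)..(s - 1), f u = 0 := by
  obtain ⟨h1, h2, h3⟩ := window_integral_split hi hf s t
  have hba := cross_integral_nonneg hi (κ := κ) (show s - 1 ≤ t by linarith) hts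
    fun u hu v hv => h u v (by linarith [hu.2, hv.1]) (by linarith [hu.1, hv.2])
  rw [hA] at h1
  rw [h2, eq_neg_of_add_eq_zero_right h1.symm] at hba
  set α := ∫ u in (t - 1)..(s - 1), f u
  have h4 : κ * (conj (-α) * (w * α)).im = -(κ * w.im * normSq α) := by
    simp [normSq_apply]
    ring
  rw [h4] at hba
  have h5 : normSq α ≤ 0 := by
    by_contra! h6
    have := mul_pos hκ h6
    linarith
  exact normSq_eq_zero.1 (le_antisymm h5 (normSq_nonneg _))

theorem splineSeries_zpow_add_one (hw : w ≠ 0) (t : ℝ) :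
    splineSeries l₀ L (fun j => w ^ j) (t + 1) = w * splineSeries l₀ L (fun j => w ^ j) t := by
  have := splineSeries_add_int (l₀ := l₀) (L := L) (a := fun j => w ^ j) (t := t) 1
  rw [Int.cast_one] at this
  rw [this, ← splineSeries_const_mul]
  congr 1
  ext j
  rw [zpow_add_one₀ hw, mul_comm]

theorem exp_mul_splineSeries_zpow_add_one (hw : w ≠ 0) (l u : ℝ) :
    ((Real.exp (-(l * (u + 1))) : ℝ) : ℂ) * splineSeries l₀ L (fun j => w ^ j) (u + 1) =
      ((Real.exp (-l) : ℝ) * w) *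
        (((Real.exp (-(l * u)) : ℝ) : ℂ) * splineSeries l₀ L (fun j => w ^ j) u) := by
  rw [splineSeries_zpow_add_one hw, show -(l * (u + 1)) = -l + -(l * u) by ring, Real.exp_add]
  push_cast
  ring

theorem cross_real_mul (κ x y : ℝ) (z z' : ℂ) :
    κ * (conj ((x : ℂ) * z) * ((y : ℂ) * z')).im = x * y * (κ * (conj z * z').im) := by
  simp
  ring

/-- The series with coefficients `w ^ j` turns in the direction of `w`: for `u ≤ v ≤ u + 1`, where
the values are nonzero, the argument advances from `u` to `v` by an angle between `0` and `π`, in the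
sense given by the sign of `Im w`. -/
theorem cross_splineSeries_zpow_nonneg (hw : w.im ≠ 0) (l₀ : ℝ) (L : List ℝ) (u v : ℝ)
    (huv : u ≤ v) (hvu : v ≤ u + 1) :
    0 ≤ w.im * (conj (splineSeries l₀ L (fun j => w ^ j) u) *
      splineSeries l₀ L (fun j => w ^ j) v).im := by
  have hw0 : w ≠ 0 := by rintro rfl; exact hw rfl
  induction L generalizing u v with
  | nil =>
    simp only [splineSeries_nil]
    rw [mul_comm (w ^ ⌊u⌋), mul_comm (w ^ ⌊v⌋), cross_real_mul]
    refine mul_nonneg (by positivity) ?_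
    have h1 := Int.floor_le_floor huv
    have h2 := Int.floor_le_floor hvu
    rw [Int.floor_add_one] at h2
    have h3 : ∀ z : ℂ, conj z * z = (normSq z : ℂ) := fun z => by rw [mul_comm, mul_conj]
    obtain h | h : ⌊v⌋ = ⌊u⌋ ∨ ⌊v⌋ = ⌊u⌋ + 1 := by omega
    · rw [h, h3, ofReal_im, mul_zero]
    · rw [h, zpow_add_one₀ hw0, ← mul_assoc, h3, im_ofReal_mul, mul_left_comm]
      exact mul_nonneg (normSq_nonneg _) (mul_self_nonneg _)
  | cons l L ih =>
    rw [splineSeries_cons, splineSeries_cons, cross_real_mul]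
    refine mul_nonneg (by positivity) ?_
    refine cross_window_integral_nonneg (w := (Real.exp (-l) : ℝ) * w)
      (fun x y => intervalIntegrable_exp_mul_splineSeries ..)
      (exp_mul_splineSeries_zpow_add_one hw0 l) ?_ (fun u v hu hv => ?_) huv hvu
    · rw [im_ofReal_mul, mul_left_comm]
      exact mul_pos (Real.exp_pos _) (mul_self_pos.2 hw)
    · rw [cross_real_mul]
      exact mul_nonneg (by positivity) (ih u v hu hv)

/-- If the value at `0` vanished, then by the case of equality the series with one exponent less
would vanish on `(-1, 0)`, against local linear independence. -/
theorem splineSeries_zpow_ne_zero_of_im_ne_zero (hw : w.im ≠ 0) (l₀ l : ℝ) (L : List ℝ) :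
    splineSeries l₀ (l :: L) (fun j => w ^ j) 0 ≠ 0 := by
  have hw0 : w ≠ 0 := by rintro rfl; exact hw rfl
  intro h0
  rw [splineSeries_cons, mul_eq_zero] at h0
  have h1 := h0.resolve_left (by exact_mod_cast (Real.exp_pos _).ne')
  have h2 : Set.EqOn (splineSeries l₀ L (fun j => w ^ j)) 0
      (Set.Ioo ((-1 : ℤ) : ℝ) ((-1 : ℤ) + 1)) := by
    refine eqOn_zero_of_integral_eq_zero (l := l) fun s hs => ?_
    have := integral_eq_zero_of_window_integral_eq_zero (s := s + 1)
      (w := (Real.exp (-l) : ℝ) * w) (κ := w.im)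
      (fun x y => intervalIntegrable_exp_mul_splineSeries ..)
      (exp_mul_splineSeries_zpow_add_one hw0 l) ?_ (fun u v hu hv => ?_) h1
      (by have := hs.1; push_cast at this; linarith) (by have := hs.2; push_cast at this; linarith)
    · simpa using this
    · rw [im_ofReal_mul, mul_left_comm]
      exact mul_pos (Real.exp_pos _) (mul_self_pos.2 hw)
    · rw [cross_real_mul]
      exact mul_nonneg (by positivity) (cross_splineSeries_zpow_nonneg hw l₀ L u v hu hv)
  exact zpow_ne_zero (-1) hw0 (coeff_eq_zero_of_eqOn h2 (-1) (by omega) le_rfl)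

/-- The series with coefficients `(-1) ^ j`; it satisfies `f (t + 1) = -f t`. -/
def altSeries (l₀ : ℝ) (L : List ℝ) : ℝ → ℂ := splineSeries l₀ L fun j => (-1) ^ j

/-- For the nonvanishing of `φ*` only the point `exp (I * ξ) = -1` of the unit circle is in doubt:
the other points are non-real, or `1`, where the series is positive. -/
theorem phiStar_ne_zero_of_altSeries_ne_zero (h : altSeries l₀ (l :: L) 0 ≠ 0) (ξ : ℝ) :
    phiStar (l₀ ::ₘ ((l :: L : List ℝ) : Multiset ℝ)) ξ ≠ 0 := by
  rw [phiStar_eq]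
  by_cases him : (exp (I * ξ)).im = 0
  · have hn : ‖exp (I * ξ)‖ = 1 := by rw [mul_comm, norm_exp_ofReal_mul_I]
    have hr : exp (I * ξ) = ((exp (I * ξ)).re : ℂ) := by
      apply Complex.ext <;> simp [him]
    rw [hr, norm_real, Real.norm_eq_abs] at hn
    rcases eq_or_eq_neg_of_abs_eq hn with h1 | h1
    · rw [hr, h1]
      intro h2
      have := splineSeries_re_pos (l₀ := l₀) (L := l :: L) (t := 0)
        (a := fun j => ((1 : ℝ) : ℂ) ^ j) (by simp)
      rw [h2] at this
      simp at this
    · rw [hr, h1]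
      push_cast
      exact h
  · exact splineSeries_zpow_ne_zero_of_im_ne_zero him _ _ _

theorem altSeries_add_one : altSeries l₀ L (t + 1) = -altSeries l₀ L t := by
  rw [altSeries, splineSeries_zpow_add_one (by norm_num)]
  ring

theorem splineSeries_coeffDiff_alt : splineSeries l₀ L (coeffDiff l fun j => (-1) ^ j) t =
    ((1 + Real.exp (-l) : ℝ) : ℂ) * altSeries l₀ L t := by
  have h := altSeries_add_one (l₀ := l₀) (L := L) (t := t - 1)
  rw [sub_add_cancel] at h
  rw [splineSeries_coeffDiff, ← altSeries, h]
  push_cast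
  ring

theorem hasDerivWithinAt_exp_mul_altSeries (l₀ l : ℝ) (L : List ℝ) (t : ℝ) :
    HasDerivWithinAt (fun t : ℝ => ((Real.exp (-(l * t)) : ℝ) : ℂ) * altSeries l₀ (l :: L) t)
      ((1 + Real.exp (-l) : ℝ) * ((Real.exp (-(l * t)) : ℝ) * altSeries l₀ L t)) (Set.Ioi t) t := by
  have := hasDerivWithinAt_exp_mul_splineSeries l₀ l L (fun j => (-1) ^ j) t
  rwa [splineSeries_coeffDiff_alt, mul_left_comm] at this

/-- Integration by parts over one period. -/
theorem integral_altSeries_mul_cons (a₀ b₀ b : ℝ) (A B : List ℝ) :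
    ((1 + Real.exp b : ℝ) : ℂ) * ∫ t in (0 : ℝ)..1, altSeries a₀ A t * altSeries b₀ (b :: B) t =
      -((1 + Real.exp (-b) : ℝ) *
        ∫ t in (0 : ℝ)..1, altSeries a₀ (-b :: A) t * altSeries b₀ B t) := by
  have hE : ∀ t : ℝ, ((Real.exp (-(-b * t)) : ℝ) : ℂ) * (Real.exp (-(b * t)) : ℝ) = 1 := by
    intro t
    rw [← ofReal_mul, ← Real.exp_add]
    simp
  have h := intervalIntegral.integral_mul_deriv_eq_deriv_mul_of_hasDeriv_right
    (a := 0) (b := 1)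
    (u := fun t : ℝ => ((Real.exp (-(-b * t)) : ℝ) : ℂ) * altSeries a₀ (-b :: A) t)
    (v := fun t : ℝ => ((Real.exp (-(b * t)) : ℝ) : ℂ) * altSeries b₀ (b :: B) t)
    ((Continuous.mul (by fun_prop) (continuous_splineSeries_cons ..)).continuousOn)
    ((Continuous.mul (by fun_prop) (continuous_splineSeries_cons ..)).continuousOn)
    (fun x _ => hasDerivWithinAt_exp_mul_altSeries a₀ (-b) A x)
    (fun x _ => hasDerivWithinAt_exp_mul_altSeries b₀ b B x)
    ((intervalIntegrable_exp_mul_splineSeries ..).const_mul _)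
    ((intervalIntegrable_exp_mul_splineSeries ..).const_mul _)
  have h1 : ∀ a₀ A, altSeries a₀ A 1 = -altSeries a₀ A 0 := fun a₀ A => by
    simpa using altSeries_add_one (l₀ := a₀) (L := A) (t := 0)
  have h2 : ∀ t : ℝ, ((Real.exp (-(-b * t)) : ℝ) : ℂ) * altSeries a₀ (-b :: A) t *
      (((1 + Real.exp (-b) : ℝ) : ℂ) * ((Real.exp (-(b * t)) : ℝ) * altSeries b₀ B t)) =
      ((1 + Real.exp (-b) : ℝ) : ℂ) * (altSeries a₀ (-b :: A) t * altSeries b₀ B t) := fun t => by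
    linear_combination (((1 + Real.exp (-b) : ℝ) : ℂ) *
      (altSeries a₀ (-b :: A) t * altSeries b₀ B t)) * hE t
  have h3 : ∀ t : ℝ, (((1 + Real.exp (- -b) : ℝ) : ℂ) *
      ((Real.exp (-(-b * t)) : ℝ) * altSeries a₀ A t)) *
      (((Real.exp (-(b * t)) : ℝ) : ℂ) * altSeries b₀ (b :: B) t) =
      ((1 + Real.exp b : ℝ) : ℂ) * (altSeries a₀ A t * altSeries b₀ (b :: B) t) := fun t => by
    rw [neg_neg]
    linear_combination (((1 + Real.exp b : ℝ) : ℂ) *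
      (altSeries a₀ A t * altSeries b₀ (b :: B) t)) * hE t
  simp only [h2, h3, intervalIntegral.integral_const_mul, h1] at h
  have h4 := hE 0
  have h5 := hE 1
  rw [h]
  linear_combination (altSeries a₀ (-b :: A) 0 * altSeries b₀ (b :: B) 0) * (h5 - h4)

/-- Integration by parts over a period moves the exponents of the second factor one by one, with
opposite sign, to the first factor. There are no boundary terms, since the product of two antiperiodic
functions is periodic, and the last step is the evaluation of an integral over a window. -/
theorem exists_integral_altSeries_mul (a₀ b₀ : ℝ) (A B : List ℝ) : ∃ κ : ℂ,
    ∫ t in (0 : ℝ)..1, altSeries a₀ A t * altSeries b₀ B t =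
      κ * altSeries a₀ (-b₀ :: ((B.map fun b => -b).reverse ++ A)) 0 := by
  induction B generalizing A with
  | nil =>
    have h1 : altSeries a₀ (-b₀ :: A) 1 = -altSeries a₀ (-b₀ :: A) 0 := by
      simpa using altSeries_add_one (l₀ := a₀) (L := -b₀ :: A) (t := 0)
    have h2 : altSeries a₀ (-b₀ :: A) 1 =
        ∫ s in (0 : ℝ)..1, ((Real.exp (-(-b₀ * s)) : ℝ) : ℂ) * altSeries a₀ A s := by
      rw [altSeries, splineSeries_cons]
      simp [altSeries]
    refine ⟨-(Real.exp (-b₀) : ℝ), ?_⟩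
    simp only [List.map_nil, List.reverse_nil, List.nil_append]
    rw [neg_mul, ← mul_neg, ← h1, h2, ← intervalIntegral.integral_const_mul]
    have h3 : ∀ᵐ u : ℝ, u ≠ 1 := by simp [ae_iff]
    refine intervalIntegral.integral_congr_ae ?_
    filter_upwards [h3] with u hu hu'
    rw [Set.uIoc_of_le zero_le_one] at hu'
    have hf : ⌊u⌋ = 0 := by
      rw [Int.floor_eq_zero_iff]
      exact ⟨hu'.1.le, lt_of_le_of_ne hu'.2 hu⟩
    have h4 : altSeries b₀ [] u = (Real.exp (-b₀) : ℝ) * (Real.exp (-(-b₀ * u)) : ℝ) := by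
      rw [altSeries, splineSeries_nil, Int.fract, hf, ← ofReal_mul, ← Real.exp_add]
      simp only [zpow_zero, one_mul, Int.cast_zero, sub_zero]
      congr 2
      ring
    rw [h4]
    ring
  | cons b B ih =>
    obtain ⟨κ, hκ⟩ := ih (-b :: A)
    have h := integral_altSeries_mul_cons a₀ b₀ b A B
    have h1 : ((1 + Real.exp b : ℝ) : ℂ) ≠ 0 := by exact_mod_cast (by positivity)
    refine ⟨((1 + Real.exp b : ℝ) : ℂ)⁻¹ * -((1 + Real.exp (-b) : ℝ) * κ), ?_⟩
    apply mul_left_cancel₀ h1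
    rw [h, hκ, mul_assoc ((1 + Real.exp b : ℝ) : ℂ)⁻¹, mul_inv_cancel_left₀ h1]
    simp only [List.map_cons, List.reverse_cons, List.append_assoc, List.singleton_append]
    ring

theorem integral_altSeries_mul_self_ne_zero (a₀ : ℝ) (A : List ℝ) :
    ∫ t in (0 : ℝ)..1, altSeries a₀ A t * altSeries a₀ A t ≠ 0 := by
  obtain ⟨g, hg, hga⟩ := exists_eqOn_Ico a₀ A (fun j => (-1) ^ j) 0
  rw [Int.cast_zero, zero_add] at hga
  have hre : ∀ t, altSeries a₀ A t = ((altSeries a₀ A t).re : ℂ) := fun t => by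
    have : (altSeries a₀ A t).im = 0 := splineSeries_im_eq_zero fun j => by
      rcases Int.even_or_odd j with h | h <;> simp [h.neg_one_zpow]
    apply Complex.ext <;> simp [this]
  intro h0
  have h1 : ∫ t in Set.Ioo (0 : ℝ) 1, (g t).re * (g t).re = 0 := by
    rw [← integral_Ioc_eq_integral_Ioo, ← intervalIntegral.integral_of_le zero_le_one]
    have : ∫ t in (0 : ℝ)..1, altSeries a₀ A t * altSeries a₀ A t =
        ((∫ t in (0 : ℝ)..1, (g t).re * (g t).re : ℝ) : ℂ) := by
      rw [← intervalIntegral.integral_ofReal]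
      have h3 : ∀ᵐ u : ℝ, u ≠ 1 := by simp [ae_iff]
      refine intervalIntegral.integral_congr_ae ?_
      filter_upwards [h3] with u hu hu'
      rw [Set.uIoc_of_le zero_le_one] at hu'
      rw [ofReal_mul, ← hga ⟨hu'.1.le, lt_of_le_of_ne hu'.2 hu⟩, ← altSeries, ← hre]
    rw [this] at h0
    exact_mod_cast h0
  have hgc := hg.1.continuous
  have hc : Continuous fun t => (g t).re := continuous_re.comp hgc
  rw [integral_eq_zero_iff_of_nonneg (fun t => mul_self_nonneg _)
    ((hc.mul hc).integrableOn_Icc.mono_set Set.Ioo_subset_Icc_self)] at h1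
  have h2 := Measure.eqOn_open_of_ae_eq h1 isOpen_Ioo (hc.mul hc).continuousOn continuousOn_const
  have h3 : Set.EqOn (altSeries a₀ A) 0 (Set.Ioo ((0 : ℤ) : ℝ) ((0 : ℤ) + 1)) := by
    intro t ht
    rw [Int.cast_zero, zero_add] at ht
    have h4 := h2 ht
    simp only [Pi.zero_apply, mul_self_eq_zero] at h4
    rw [hre, altSeries, hga (Set.Ioo_subset_Ico_self ht), h4]
    simp
  simpa using coeff_eq_zero_of_eqOn h3 0 (by omega) le_rfl

theorem altSeries_perm {l₀ l l₀' l' : ℝ} {L L' : List ℝ}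
    (h : (l₀ :: l :: L).Perm (l₀' :: l' :: L')) (t : ℝ) :
    altSeries l₀ (l :: L) t = altSeries l₀' (l' :: L') t := splineSeries_perm h _ t

/-- If `Λ = M + (-M)`, then the value at `0` is, up to a factor, the integral of the square of the
real function `altSeries` for `M`. -/
theorem altSeries_ne_zero_of_eq_add_neg {M : Multiset ℝ} (hM : M ≠ 0)
    (h : l₀ ::ₘ ((l :: L : List ℝ) : Multiset ℝ) = M + M.map fun l => -l) :
    altSeries l₀ (l :: L) 0 ≠ 0 := by
  obtain ⟨A, rfl⟩ := Quot.exists_rep M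
  cases A with
  | nil => exact absurd rfl hM
  | cons a₀ A =>
    obtain ⟨κ, hκ⟩ := exists_integral_altSeries_mul a₀ a₀ A A
    intro h0
    refine integral_altSeries_mul_self_ne_zero a₀ A (hκ.trans ?_)
    rw [altSeries_perm (l₀' := l₀) (l' := l) (L' := L), h0, mul_zero]
    rw [← Multiset.coe_eq_coe, ← Multiset.cons_coe l₀, h]
    change _ = ((a₀ :: A : List ℝ) : Multiset ℝ) + Multiset.map _ ((a₀ :: A : List ℝ) : Multiset ℝ)
    rw [Multiset.map_coe, Multiset.coe_add, Multiset.coe_eq_coe, List.map_cons, List.cons_append]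
    refine List.Perm.cons _ ?_
    refine (List.Perm.cons _ ?_).trans List.perm_middle.symm
    exact List.perm_append_comm.trans ((List.reverse_perm _).append_left A)

/-- The multiplicity of `0` in a symmetric vector of even length is even. -/
theorem IsSymmetric.exists_eq_add_neg (h : IsSymmetric Λ) {p : ℕ} (hc : Λ.card = 2 * p) :
    ∃ M : Multiset ℝ, Λ = M + M.map fun l => -l := by
  have h1 : Λ.filter (fun l => l < 0) = (Λ.filter fun l => 0 < l).map fun l => -l := by
    conv_lhs => rw [← h, Multiset.filter_map]
    simp
  have h2 : Λ.filter (fun l => l = 0) = Multiset.replicate (Λ.count 0) 0 := Multiset.filter_eq' Λ 0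
  have h3 : Λ = Λ.filter (fun l => 0 < l) + Λ.filter (fun l => l < 0) +
      Λ.filter (fun l => l = 0) := by
    conv_lhs => rw [← Multiset.filter_add_not (fun l => 0 < l) Λ,
      ← Multiset.filter_add_not (fun l => l < 0) (Λ.filter fun l => ¬ 0 < l)]
    rw [Multiset.filter_filter, Multiset.filter_filter, add_assoc]
    congr 2
    · refine Multiset.filter_congr fun l _ => ?_
      constructor
      · exact fun h => h.1
      · exact fun h => ⟨h, by linarith⟩
    · refine Multiset.filter_congr fun l _ => ?_
      constructor
      · exact fun h => by linarith [not_lt.1 h.1, not_lt.1 h.2]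
      · rintro rfl
        simp
  rw [h1, h2] at h3
  have h4 : Even (Λ.count 0) := by
    have := congrArg Multiset.card h3
    rw [Multiset.card_add, Multiset.card_add, Multiset.card_map, Multiset.card_replicate, hc] at this
    rw [Nat.even_iff]
    omega
  obtain ⟨q, hq⟩ := h4
  refine ⟨Λ.filter (fun l => 0 < l) + Multiset.replicate q 0, ?_⟩
  conv_lhs => rw [h3, hq, Multiset.replicate_add]
  rw [Multiset.map_add, Multiset.map_replicate, neg_zero]
  abel

end

/-! ### Divided differences and the transcendence of `e` -/

section

variable {l₀ l : ℝ} {L : List ℝ} {a b : ℤ → ℂ} {t s : ℝ} {f g : ℝ → ℂ} {Λ : Multiset ℝ} {w : ℂ}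

/-- Hermite's argument for the transcendence of `e`, with the simultaneous approximations to the
powers of `e` from `LindemannWeierstrass.exp_polynomial_approx`: for a large prime `p`, a root would
give an integer of absolute value less than one that is not divisible by `p`. -/
theorem aeval_exp_one_ne_zero {P : ℤ[X]} (hP : P.coeff 0 ≠ 0) : aeval (exp 1) P ≠ 0 := by
  intro hroot
  set d := P.natDegree with hd
  -- the nonzero exponents in `P(e)` lie among the roots `1, …, d` of `F`
  set F : ℤ[X] := ∏ k ∈ Finset.range d, (X - C ((k : ℤ) + 1)) with hF
  have hF0 : F.eval 0 ≠ 0 := by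
    rw [hF, eval_prod, Finset.prod_ne_zero_iff]
    intro k _
    simp
    omega
  have hFmonic : F.Monic := monic_prod_of_monic _ _ fun k _ => monic_X_sub_C _
  have hFr : ∀ k < d, ((k : ℂ) + 1) ∈ F.aroots ℂ := by
    intro k hk
    rw [mem_aroots]
    refine ⟨hFmonic.ne_zero, ?_⟩
    rw [hF, map_prod]
    refine Finset.prod_eq_zero (Finset.mem_range.2 hk) ?_
    simp
  obtain ⟨c, hc⟩ := LindemannWeierstrass.exp_polynomial_approx F hF0
  set A : ℝ := ∑ k ∈ Finset.range d, ‖((P.coeff (k + 1) : ℤ) : ℂ)‖ with hA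
  have hlim : Filter.Tendsto (fun m : ℕ => A * (c * (c ^ m / (m.factorial : ℝ)))) Filter.atTop
      (nhds (A * (c * 0))) :=
    ((FloorSemiring.tendsto_pow_div_factorial_atTop c).const_mul _).const_mul _
  rw [mul_zero, mul_zero] at hlim
  obtain ⟨m₀, hm₀⟩ := Filter.eventually_atTop.1 (hlim.eventually_lt_const one_pos)
  obtain ⟨p, hpge, hp⟩ := Nat.exists_infinite_primes
    (m₀ + (F.eval 0).natAbs + (P.coeff 0).natAbs + 2)
  obtain ⟨n, hpn, gp, -, happrox⟩ := hc p (by omega) hp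
  -- an integer which is nonzero modulo `p` and of absolute value less than one
  set J : ℤ := n * P.coeff 0 + p * ∑ k ∈ Finset.range d, P.coeff (k + 1) * gp.eval ((k : ℤ) + 1)
    with hJ
  have hpp : Prime (p : ℤ) := Nat.prime_iff_prime_int.1 hp
  have hJ0 : J ≠ 0 := by
    intro h0
    have h1 : (p : ℤ) ∣ n * P.coeff 0 := by
      refine ⟨-∑ k ∈ Finset.range d, P.coeff (k + 1) * gp.eval ((k : ℤ) + 1), ?_⟩
      rw [hJ] at h0
      linarith
    rcases hpp.dvd_or_dvd h1 with h | h
    · exact hpn h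
    · have := Int.natAbs_dvd_natAbs.2 h
      have := Nat.le_of_dvd (Int.natAbs_pos.2 hP) this
      simp at this
      omega
  have hsum : ((P.coeff 0 : ℤ) : ℂ) +
      ∑ k ∈ Finset.range d, ((P.coeff (k + 1) : ℤ) : ℂ) * exp ((k : ℂ) + 1) = 0 := by
    rw [aeval_eq_sum_range, Finset.sum_range_succ'] at hroot
    rw [← hroot, add_comm]
    congr 1
    · refine Finset.sum_congr rfl fun k _ => ?_
      rw [← exp_nat_mul, zsmul_eq_mul]
      push_cast
      rw [mul_one]
    · simp
  have hJc : (J : ℂ) = -∑ k ∈ Finset.range d, ((P.coeff (k + 1) : ℤ) : ℂ) *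
      (n • exp ((k : ℂ) + 1) - p • aeval ((k : ℂ) + 1) gp) := by
    have hgp : ∀ k : ℕ, aeval ((k : ℂ) + 1) gp = ((gp.eval ((k : ℤ) + 1) : ℤ) : ℂ) := by
      intro k
      have := aeval_algebraMap_apply_eq_algebraMap_eval (A := ℂ) ((k : ℤ) + 1) gp
      simpa using this
    simp only [hgp, zsmul_eq_mul, nsmul_eq_mul]
    simp only [mul_sub, Finset.sum_sub_distrib, mul_left_comm _ (n : ℂ), mul_left_comm _ (p : ℂ),
      ← Finset.mul_sum]
    rw [hJ]
    push_cast
    linear_combination (n : ℂ) * hsum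
  have hJle : ‖(J : ℂ)‖ ≤ A * (c ^ p / ((p - 1).factorial : ℝ)) := by
    rw [hJc, norm_neg, hA, Finset.sum_mul]
    refine norm_sum_le_of_le _ fun k hk => ?_
    rw [norm_mul]
    gcongr
    exact happrox (hFr k (Finset.mem_range.1 hk))
  have hlt := hm₀ (p - 1) (by omega)
  have heq : c * (c ^ (p - 1) / ((p - 1).factorial : ℝ)) = c ^ p / ((p - 1).factorial : ℝ) := by
    rw [← mul_div_assoc, ← pow_succ', Nat.sub_add_cancel hp.one_le]
  rw [heq] at hlt
  have h1 : (1 : ℝ) ≤ ‖(J : ℂ)‖ := by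
    rw [norm_intCast]
    exact_mod_cast Int.one_le_abs hJ0
  linarith

/-- The general case reduces to a nonzero constant coefficient by dividing out a power of the
variable. -/
theorem transcendental_exp_one : Transcendental ℤ (exp 1) := by
  intro h
  obtain ⟨P, hP, hroot⟩ := h.exists_nonzero_coeff_and_aeval_eq_zero
    (mem_nonZeroDivisors_of_ne_zero (exp_ne_zero 1))
  exact aeval_exp_one_ne_zero hP hroot

/-- The specialization `e ↦ ζ`, as the ring of pairs `(P(e) / Q(e), P(ζ) / Q(ζ))` with `P`, `Q`
integer polynomials and `Q(ζ) ≠ 0`. It is the graph of a function because `e` is transcendental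
(`eq_zero_of_mem_specialization`); membership of a pair with first entry `x` says that `x`, as a
rational function of `e`, has no pole at `ζ`. -/
def specialization (ζ : ℂ) : Subring (ℂ × ℂ) where
  carrier := {z | ∃ P Q : ℤ[X], aeval ζ Q ≠ 0 ∧ z.1 * aeval (exp 1) Q = aeval (exp 1) P ∧
    z.2 * aeval ζ Q = aeval ζ P}
  mul_mem' := by
    rintro x y ⟨P, Q, hQ, h1, h2⟩ ⟨P', Q', hQ', h1', h2'⟩
    refine ⟨P * P', Q * Q', by simpa using ⟨hQ, hQ'⟩, ?_, ?_⟩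
    · rw [map_mul, map_mul, Prod.fst_mul, ← h1, ← h1']; ring
    · rw [map_mul, map_mul, Prod.snd_mul, ← h2, ← h2']; ring
  one_mem' := ⟨1, 1, by simp⟩
  add_mem' := by
    rintro x y ⟨P, Q, hQ, h1, h2⟩ ⟨P', Q', hQ', h1', h2'⟩
    refine ⟨P * Q' + P' * Q, Q * Q', by simpa using ⟨hQ, hQ'⟩, ?_, ?_⟩
    · simp only [map_mul, map_add, Prod.fst_add, ← h1, ← h1']; ring
    · simp only [map_mul, map_add, Prod.snd_add, ← h2, ← h2']; ring
  zero_mem' := ⟨0, 1, by simp⟩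
  neg_mem' := by
    rintro x ⟨P, Q, hQ, h1, h2⟩
    exact ⟨-P, Q, hQ, by simp [h1], by simp [h2]⟩

variable {ζ x v y u : ℂ}

/-- A rational function that vanishes at `e` is zero, and so it vanishes at `ζ`. -/
theorem eq_zero_of_mem_specialization (h : ((0 : ℂ), v) ∈ specialization ζ) : v = 0 := by
  obtain ⟨P, Q, hQ, h1, h2⟩ := h
  rw [zero_mul] at h1
  rw [(transcendental_iff.1 transcendental_exp_one) P h1.symm, map_zero, mul_eq_zero] at h2
  exact h2.resolve_right hQ

theorem inv_mem_specialization (h : (x, v) ∈ specialization ζ) (hv : v ≠ 0) :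
    (x⁻¹, v⁻¹) ∈ specialization ζ := by
  have hx : x ≠ 0 := fun hx => hv (eq_zero_of_mem_specialization (hx ▸ h))
  obtain ⟨P, Q, hQ, h1, h2⟩ := h
  simp only at h1 h2
  refine ⟨Q, P, ?_, ?_, ?_⟩
  · rw [← h2]
    exact mul_ne_zero hv hQ
  · simp only
    rw [← h1, inv_mul_cancel_left₀ hx]
  · simp only
    rw [← h2, inv_mul_cancel_left₀ hv]

theorem mul_mem_specialization (h : (x, v) ∈ specialization ζ) (h' : (y, u) ∈ specialization ζ) :
    (x * y, v * u) ∈ specialization ζ := mul_mem h h'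

theorem sub_mem_specialization (h : (x, v) ∈ specialization ζ) (h' : (y, u) ∈ specialization ζ) :
    (x - y, v - u) ∈ specialization ζ := sub_mem h h'

theorem intCast_mem_specialization (n : ℤ) : ((n : ℂ), (n : ℂ)) ∈ specialization ζ :=
  intCast_mem _ n

theorem zpow_mem_specialization (hζ : ζ ≠ 0) (n : ℤ) : (exp 1 ^ n, ζ ^ n) ∈ specialization ζ := by
  have h1 : (exp 1, ζ) ∈ specialization ζ := ⟨X, 1, by simp⟩
  have h2 : ∀ n : ℕ, (exp 1 ^ n, ζ ^ n) ∈ specialization ζ := fun n => pow_mem h1 n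
  cases n with
  | ofNat n => simpa using h2 n
  | negSucc n =>
    rw [zpow_negSucc, zpow_negSucc]
    exact inv_mem_specialization (h2 _) (pow_ne_zero _ hζ)

theorem one_add_zpow_mem_specialization (hζ : ζ ≠ 0) (n : ℤ) :
    (1 + exp 1 ^ n, 1 + ζ ^ n) ∈ specialization ζ :=
  add_mem (one_mem _) (zpow_mem_specialization hζ n)

/-- `altSeries` at `0`, divided by the product of the factors `1 + exp (-l)` over all exponents `l`;
the value at the empty list is immaterial. -/
def altValueList : List ℝ → ℂ
  | [] => 0
  | l₀ :: L => altSeries l₀ L 0 / ((l₀ :: L).map fun l => ((1 + Real.exp (-l) : ℝ) : ℂ)).prod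

theorem altValueList_perm {L L' : List ℝ} (h : L.Perm L') :
    altValueList L = altValueList L' := by
  match L, L', h with
  | [], L', h => rw [List.nil_perm.1 h]
  | [l], L', h => rw [List.singleton_perm.1 h]
  | _ :: _ :: _, [], h => exact absurd h.length_eq (by simp)
  | _ :: _ :: _, [_], h => exact absurd h.length_eq (by simp)
  | l₀ :: l :: L, l₀' :: l' :: L', h =>
    rw [altValueList, altValueList, altSeries_perm h, (h.map _).prod_eq]

/-- The value `altValueList` for a multiset of exponents. By `sub_mul_altValue_cons_cons` and
`altValue_singleton` it is the divided difference of the function `1 / (1 + exp x)` at the points of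
`Λ`. -/
def altValue (Λ : Multiset ℝ) : ℂ := Quot.liftOn Λ altValueList fun _ _ h => altValueList_perm h

theorem altValue_coe : altValue (l₀ ::ₘ (L : Multiset ℝ)) =
    altSeries l₀ L 0 / ((l₀ :: L).map fun l => ((1 + Real.exp (-l) : ℝ) : ℂ)).prod := rfl

theorem one_add_exp_ne_zero (l : ℝ) : ((1 + Real.exp l : ℝ) : ℂ) ≠ 0 := by
  exact_mod_cast (by positivity)

theorem hasDerivWithinAt_altSeries (l₀ l : ℝ) (L : List ℝ) :
    HasDerivWithinAt (altSeries l₀ (l :: L)) (l * altSeries l₀ (l :: L) 0 +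
      (1 + Real.exp (-l) : ℝ) * altSeries l₀ L 0) (Set.Ioi 0) 0 := by
  have h1 : HasDerivWithinAt (fun u : ℝ => ((Real.exp (l * u) : ℝ) : ℂ))
      ((Real.exp (l * 0) * (l * 1) : ℝ) : ℂ) (Set.Ioi 0) 0 :=
    ((((hasDerivAt_id (0 : ℝ)).const_mul l).exp).ofReal_comp).hasDerivWithinAt
  have h2 := h1.mul (hasDerivWithinAt_exp_mul_altSeries l₀ l L 0)
  have h3 : ((fun u : ℝ => ((Real.exp (l * u) : ℝ) : ℂ)) * fun t : ℝ =>
      ((Real.exp (-(l * t)) : ℝ) : ℂ) * altSeries l₀ (l :: L) t) = altSeries l₀ (l :: L) := by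
    ext t
    exact exp_mul_exp_neg l t _
  rw [h3] at h2
  refine h2.congr_deriv ?_
  simp

/-- The recursion of divided differences. It results from computing the right derivative of
`altSeries` at `0` with `x`, or with `y`, as the exponent that is split off. -/
theorem sub_mul_altValue_cons_cons (x y : ℝ) (Λ : Multiset ℝ) :
    ((x : ℂ) - y) * altValue (x ::ₘ y ::ₘ Λ) = altValue (x ::ₘ Λ) - altValue (y ::ₘ Λ) := by
  obtain ⟨L, rfl⟩ := Quot.exists_rep Λ
  change _ * altValue (x ::ₘ ((y :: L : List ℝ) : Multiset ℝ)) =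
    altValue (x ::ₘ (L : Multiset ℝ)) - altValue (y ::ₘ (L : Multiset ℝ))
  rw [altValue_coe, altValue_coe, altValue_coe]
  have h1 := hasDerivWithinAt_altSeries x y L
  have h2 := hasDerivWithinAt_altSeries y x L
  have h3 : altSeries y (x :: L) = altSeries x (y :: L) :=
    funext fun t => altSeries_perm (List.Perm.swap x y L) t
  rw [h3] at h2
  have h4 := (uniqueDiffWithinAt_Ioi (0 : ℝ)).eq_deriv _ h1 h2
  have hx := one_add_exp_ne_zero (-x)
  have hy := one_add_exp_ne_zero (-y)
  have hL : (L.map fun l => ((1 + Real.exp (-l) : ℝ) : ℂ)).prod ≠ 0 := by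
    rw [Ne, List.prod_eq_zero_iff, List.mem_map]
    rintro ⟨l, -, h⟩
    exact one_add_exp_ne_zero _ h
  simp only [List.map_cons, List.prod_cons]
  generalize (L.map fun l => ((1 + Real.exp (-l) : ℝ) : ℂ)).prod = q at *
  generalize ((1 + Real.exp (-x) : ℝ) : ℂ) = X at *
  generalize ((1 + Real.exp (-y) : ℝ) : ℂ) = Y at *
  field_simp
  linear_combination -h4

theorem altValue_singleton (n : ℤ) : altValue {(n : ℝ)} = (1 + exp 1 ^ n)⁻¹ := by
  have h : altValue {(n : ℝ)} = altSeries n [] 0 /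
    (([(n : ℝ)]).map fun l => ((1 + Real.exp (-l) : ℝ) : ℂ)).prod := rfl
  rw [h, altSeries, splineSeries_nil, ← exp_int_mul, mul_one]
  have h1 := exp_ne_zero (n : ℂ)
  have h3 := one_add_exp_ne_zero n
  simp only [Int.floor_zero, zpow_zero, Int.fract_zero, List.map_cons, List.map_nil, List.prod_cons,
    List.prod_nil]
  push_cast at *
  simp only [exp_neg, zero_sub, mul_neg, mul_one, one_mul] at *
  have h4 : 1 + (exp (n : ℂ))⁻¹ = (1 + exp n) / exp n := by
    rw [add_div, div_self h1, one_div, add_comm]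
  rw [h4]
  field_simp

theorem altValue_pair (n : ℤ) :
    altValue {(n : ℝ), (n : ℝ)} = -(exp 1 ^ n * ((1 + exp 1 ^ n) ^ 2)⁻¹) := by
  have h : altValue {(n : ℝ), (n : ℝ)} = altSeries n [(n : ℝ)] 0 /
    (([(n : ℝ), (n : ℝ)]).map fun l => ((1 + Real.exp (-l) : ℝ) : ℂ)).prod := rfl
  have h0 : altSeries n [(n : ℝ)] 1 = (Real.exp (-n) : ℝ) := by
    rw [altSeries, splineSeries_cons]
    have : ∫ s in (1 - 1 : ℝ)..1, ((Real.exp (-(n * s)) : ℝ) : ℂ) *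
        splineSeries n [] (fun j => (-1) ^ j) s =
          ∫ s in (1 - 1 : ℝ)..1, ((Real.exp (-n) : ℝ) : ℂ) := by
      have h3 : ∀ᵐ u : ℝ, u ≠ 1 := by simp [ae_iff]
      refine intervalIntegral.integral_congr_ae ?_
      filter_upwards [h3] with u hu hu'
      rw [Set.uIoc_of_le (by norm_num)] at hu'
      have hf : ⌊u⌋ = 0 := by
        rw [Int.floor_eq_zero_iff]
        exact ⟨by linarith [hu'.1], lt_of_le_of_ne hu'.2 hu⟩
      rw [splineSeries_nil, Int.fract, hf, zpow_zero, one_mul, ← ofReal_mul, ← Real.exp_add]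
      congr 2
      push_cast
      ring
    rw [this]
    simp
  have h00 : altSeries n [(n : ℝ)] 0 = -(Real.exp (-n) : ℝ) := by
    have := altSeries_add_one (l₀ := n) (L := [(n : ℝ)]) (t := 0)
    rw [zero_add, h0] at this
    rw [this, neg_neg]
  rw [h, h00, ← exp_int_mul, mul_one]
  have h1 := exp_ne_zero (n : ℂ)
  have h3 := one_add_exp_ne_zero n
  simp only [List.map_cons, List.map_nil, List.prod_cons, List.prod_nil]
  push_cast at *
  simp only [exp_neg, mul_one] at *
  have h4 : 1 + (exp (n : ℂ))⁻¹ = (1 + exp n) / exp n := by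
    rw [add_div, div_self h1, one_div, add_comm]
  rw [h4]
  field_simp

end

/-! ### Nonvanishing at `-1` for nearly symmetric vectors -/

section

variable {l₀ l : ℝ} {L : List ℝ} {ζ : ℂ} {μ : ℤ} {Λ : Multiset ℤ}

/-- The witness is `exp (π * I / μ)`. -/
theorem exists_zpow_eq_neg_one (hμ : μ ≠ 0) :
    ∃ ζ : ℂ, ζ ≠ 0 ∧ ζ ^ μ = -1 ∧ ∀ n : ℤ, |n| < |μ| → 1 + ζ ^ n ≠ 0 := by
  have hμ' : (μ : ℂ) ≠ 0 := by exact_mod_cast hμ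
  refine ⟨exp (Real.pi * I / μ), exp_ne_zero _, ?_, fun n hn h => ?_⟩
  · rw [← exp_int_mul, mul_div_cancel₀ _ hμ', exp_pi_mul_I]
  · rw [← exp_int_mul] at h
    have h1 : exp (n * (Real.pi * I / μ) - Real.pi * I) = 1 := by
      rw [exp_sub, eq_neg_of_add_eq_zero_right h, exp_pi_mul_I, div_self (by norm_num)]
    obtain ⟨m, hm⟩ := exp_eq_one_iff.1 h1
    have hpi : (Real.pi : ℂ) ≠ 0 := by exact_mod_cast Real.pi_ne_zero
    have h2 : (n : ℂ) = (2 * m + 1) * μ := by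
      field_simp at hm
      linear_combination hm
    have h3 : n = (2 * m + 1) * μ := by exact_mod_cast h2
    rw [h3, abs_mul] at hn
    have h4 : 1 ≤ |2 * m + 1| := Int.one_le_abs (by omega)
    nlinarith [abs_nonneg μ]

/-- The divided difference of `1 / (1 + exp x)` at integer points, a rational function of `e`. -/
def intAltValue (Λ : Multiset ℤ) : ℂ := altValue (Λ.map fun n : ℤ => (n : ℝ))

theorem sub_mul_intAltValue (x y : ℤ) (Λ : Multiset ℤ) :
    ((x : ℂ) - y) * intAltValue (x ::ₘ y ::ₘ Λ) = intAltValue (x ::ₘ Λ) - intAltValue (y ::ₘ Λ) := by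
  simpa [intAltValue] using sub_mul_altValue_cons_cons x y (Λ.map fun n : ℤ => (n : ℝ))

theorem intAltValue_eq {x y : ℤ} (hxy : x ≠ y) (Λ : Multiset ℤ) :
    intAltValue (x ::ₘ y ::ₘ Λ) =
      ((x - y : ℤ) : ℂ)⁻¹ * (intAltValue (x ::ₘ Λ) - intAltValue (y ::ₘ Λ)) := by
  have h : ((x - y : ℤ) : ℂ) ≠ 0 := by exact_mod_cast sub_ne_zero.2 hxy
  rw [← sub_mul_intAltValue, ← Int.cast_sub, inv_mul_cancel_left₀ h]

theorem intAltValue_singleton (n : ℤ) : intAltValue {n} = (1 + exp 1 ^ n)⁻¹ := by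
  rw [intAltValue, Multiset.map_singleton, altValue_singleton]

theorem intAltValue_pair (n : ℤ) :
    intAltValue {n, n} = -(exp 1 ^ n * ((1 + exp 1 ^ n) ^ 2)⁻¹) := by
  rw [← altValue_pair]
  rfl

/-- If `ζ ^ n ≠ -1` for all entries `n`, then the divided difference, as a rational function of `e`,
has no pole at `ζ`. -/
theorem exists_intAltValue_mem_specialization (hζ : ζ ≠ 0) (h0 : Λ ≠ 0)
    (hΛ : ∀ n ∈ Λ, 1 + ζ ^ n ≠ 0) (hc : ∀ n, Λ.count n ≤ 2) :
    ∃ v, (intAltValue Λ, v) ∈ specialization ζ := by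
  induction hN : Λ.card using Nat.strong_induction_on generalizing Λ with
  | _ N ih =>
  obtain ⟨x, hx⟩ := Multiset.exists_mem_of_ne_zero h0
  obtain ⟨Λ', rfl⟩ := Multiset.exists_cons_of_mem hx
  by_cases hy : ∃ y ∈ Λ', y ≠ x
  · obtain ⟨y, hy, hyx⟩ := hy
    obtain ⟨Λ, rfl⟩ := Multiset.exists_cons_of_mem hy
    have hle1 : x ::ₘ Λ ≤ x ::ₘ y ::ₘ Λ := Multiset.cons_le_cons _ (Multiset.le_cons_self _ _)
    have hle2 : y ::ₘ Λ ≤ x ::ₘ y ::ₘ Λ := Multiset.le_cons_self _ _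
    have hmem : ∀ Λ₁, Λ₁ ≤ x ::ₘ y ::ₘ Λ → Λ₁.card < N → Λ₁ ≠ 0 →
        ∃ v, (intAltValue Λ₁, v) ∈ specialization ζ := fun Λ₁ hle hlt hne =>
      ih _ hlt hne (fun n hn => hΛ n (Multiset.mem_of_le hle hn))
        (fun n => (Multiset.count_le_of_le n hle).trans (hc n)) rfl
    simp only [Multiset.card_cons] at hN
    obtain ⟨v, hv⟩ := hmem _ hle1 (by simp; omega) (Multiset.cons_ne_zero)
    obtain ⟨u, hu⟩ := hmem _ hle2 (by simp; omega) (Multiset.cons_ne_zero)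
    rw [intAltValue_eq hyx.symm]
    have hxy : ((x - y : ℤ) : ℂ) ≠ 0 := by exact_mod_cast sub_ne_zero.2 hyx.symm
    exact ⟨_, mul_mem_specialization (inv_mem_specialization (intCast_mem_specialization _) hxy)
      (sub_mem_specialization hv hu)⟩
  · push Not at hy
    have h1 := one_add_zpow_mem_specialization hζ x
    have hΛ' := Multiset.eq_replicate_card.2 hy
    have hcx := hc x
    rw [Multiset.count_cons_self, hΛ', Multiset.count_replicate_self] at hcx
    obtain h | h : Λ'.card = 0 ∨ Λ'.card = 1 := by omega
    · rw [Multiset.card_eq_zero.1 h, Multiset.cons_zero, intAltValue_singleton]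
      exact ⟨_, inv_mem_specialization h1 (hΛ x hx)⟩
    · rw [hΛ', h, Multiset.replicate_one]
      change ∃ v, (intAltValue {x, x}, v) ∈ _
      rw [intAltValue_pair]
      have h2 := inv_mem_specialization (pow_mem h1 2) (pow_ne_zero 2 (hΛ x hx))
      exact ⟨_, neg_mem (mul_mem_specialization (zpow_mem_specialization hζ x) h2)⟩

/-- If `ζ ^ μ = -1`, then adjoining points where there is no pole to the point `μ` of multiplicity
`m + 1` leaves the order of the pole at `ζ` and the nonvanishing of its leading coefficient unchanged:
in the recursion each new point `x` contributes a factor `(μ - x)⁻¹`, and the other divided difference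
has a pole of lower order. -/
theorem exists_mul_intAltValue_mem_specialization (hζ : ζ ≠ 0) (hμ : ζ ^ μ = -1) (m : ℕ)
    (hΛ : ∀ n ∈ Λ, 1 + ζ ^ n ≠ 0) (hc : ∀ n, Λ.count n ≤ 2)
    (hbase : ∃ v, v ≠ 0 ∧ ((1 + exp 1 ^ μ) ^ (m + 1) * intAltValue (Multiset.replicate (m + 1) μ), v)
      ∈ specialization ζ)
    (hm : ∀ Λ : Multiset ℤ, Λ ≠ 0 → (∀ n ∈ Λ, 1 + ζ ^ n ≠ 0) → (∀ n, Λ.count n ≤ 2) →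
      ∃ v, ((1 + exp 1 ^ μ) ^ m * intAltValue (Multiset.replicate m μ + Λ), v) ∈ specialization ζ) :
    ∃ v, v ≠ 0 ∧ ((1 + exp 1 ^ μ) ^ (m + 1) * intAltValue (Multiset.replicate (m + 1) μ + Λ), v)
      ∈ specialization ζ := by
  induction Λ using Multiset.induction_on with
  | empty => simpa using hbase
  | cons x Λ ih =>
    have hne : μ ≠ x := by
      rintro rfl
      exact hΛ μ (Multiset.mem_cons_self _ _) (by rw [hμ]; ring)
    obtain ⟨v, hv0, hv⟩ := ih (fun n hn => hΛ n (Multiset.mem_cons_of_mem hn))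
      fun n => (Multiset.count_le_of_le n (Multiset.le_cons_self _ _)).trans (hc n)
    obtain ⟨u, hu⟩ := hm (x ::ₘ Λ) Multiset.cons_ne_zero hΛ hc
    have hxy : ((μ - x : ℤ) : ℂ) ≠ 0 := by exact_mod_cast sub_ne_zero.2 hne
    have h1 := one_add_zpow_mem_specialization hζ μ
    have h2 := mul_mem_specialization
      (inv_mem_specialization (ζ := ζ) (intCast_mem_specialization _) hxy)
      (sub_mem_specialization hv (mul_mem_specialization h1 hu))
    refine ⟨((μ - x : ℤ) : ℂ)⁻¹ * (v - (1 + ζ ^ μ) * u), ?_, ?_⟩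
    rotate_left
    · convert h2 using 2
      rw [Multiset.replicate_succ, Multiset.cons_add, Multiset.add_cons, intAltValue_eq hne,
        Multiset.cons_add]
      ring
    · rw [hμ, add_neg_cancel, zero_mul, sub_zero]
      exact mul_ne_zero (inv_ne_zero hxy) hv0

/-- If an entry `μ ≠ 0` strictly dominates all other values in absolute value, then the divided
difference, as a rational function of `e`, has a pole at a number `ζ` with `ζ ^ μ = -1`. So this
rational function is nonzero, and its value at the transcendental number `e` is nonzero. -/
theorem intAltValue_ne_zero (hμ : μ ∈ Λ) (hμ0 : μ ≠ 0) (hΛ : ∀ n ∈ Λ, n ≠ μ → |n| < |μ|)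
    (hc : ∀ n, Λ.count n ≤ 2) : intAltValue Λ ≠ 0 := by
  obtain ⟨ζ, hζ, hζμ, hζn⟩ := exists_zpow_eq_neg_one hμ0
  -- `Λ'` collects the entries other than `μ`; there is no pole at `ζ` for them
  set Λ' := Λ.filter fun n => n ≠ μ with hΛ'
  have hsplit : Λ = Multiset.replicate (Λ.count μ) μ + Λ' := by
    conv_lhs => rw [← Multiset.filter_add_not (fun n => n = μ) Λ, Multiset.filter_eq']
  have h1 : ∀ n ∈ Λ', 1 + ζ ^ n ≠ 0 := fun n hn => by
    rw [hΛ', Multiset.mem_filter] at hn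
    exact hζn n (hΛ n hn.1 hn.2)
  have h2 : ∀ n, Λ'.count n ≤ 2 := fun n =>
    (Multiset.count_le_of_le n (Multiset.filter_le _ _)).trans (hc n)
  have hx := zpow_mem_specialization hζ μ
  have h1x := one_add_zpow_mem_specialization hζ μ
  -- `1 + e ^ μ` is nonzero since it is a positive real number
  have hne : 1 + exp 1 ^ μ ≠ 0 := by
    have := one_add_exp_ne_zero μ
    rw [← exp_int_mul, mul_one]
    push_cast at this
    exact this
  have hfin : ∀ m, (∃ v, v ≠ 0 ∧ ((1 + exp 1 ^ μ) ^ m *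
      intAltValue (Multiset.replicate m μ + Λ'), v) ∈ specialization ζ) →
      intAltValue (Multiset.replicate m μ + Λ') ≠ 0 := by
    rintro m ⟨v, hv0, hv⟩ h
    rw [h, mul_zero] at hv
    exact hv0 (eq_zero_of_mem_specialization hv)
  have hone : ∀ Λ : Multiset ℤ, (∀ n ∈ Λ, 1 + ζ ^ n ≠ 0) → (∀ n, Λ.count n ≤ 2) →
      ∃ v, v ≠ 0 ∧ ((1 + exp 1 ^ μ) ^ 1 * intAltValue (Multiset.replicate 1 μ + Λ), v)
        ∈ specialization ζ := by
    intro Λ h1 h2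
    refine exists_mul_intAltValue_mem_specialization hζ hζμ 0 h1 h2 ⟨1, one_ne_zero, ?_⟩
      fun Λ h0 h1 h2 => ?_
    · rw [Multiset.replicate_one, intAltValue_singleton, zero_add, pow_one, mul_inv_cancel₀ hne]
      exact one_mem _
    · simpa using exists_intAltValue_mem_specialization hζ h0 h1 h2
  rw [hsplit]
  have hpos := Multiset.count_pos.2 hμ
  obtain h | h : Λ.count μ = 1 ∨ Λ.count μ = 2 := by have := hc μ; omega
  · rw [h]
    exact hfin 1 (hone Λ' h1 h2)
  · rw [h]
    refine hfin 2 (exists_mul_intAltValue_mem_specialization hζ hζμ 1 h1 h2 ⟨1, one_ne_zero, ?_⟩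
      fun Λ _ h1 h2 => ?_)
    · have h3 : Multiset.replicate (1 + 1) μ = {μ, μ} := rfl
      rw [h3, intAltValue_pair, mul_neg, mul_left_comm, one_add_one_eq_two,
        mul_inv_cancel₀ (pow_ne_zero 2 hne), mul_one]
      have h4 := neg_mem hx
      rw [Prod.neg_mk, hζμ, neg_neg] at h4
      exact h4
    · obtain ⟨v, -, hv⟩ := hone Λ h1 h2
      exact ⟨v, hv⟩

/-- The vector `nearlySymmetric n p k`, with integer entries. -/
def intNearlySymmetric (n p : ℕ) (k : ℤ) : Multiset ℤ :=
  ((Multiset.range p).map fun j : ℕ => k + 2 * (j : ℤ)) +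
    ((Multiset.range p).map fun j : ℕ => -(n : ℤ) - k + 2 + 2 * (j : ℤ))

theorem map_intNearlySymmetric (n p : ℕ) (k : ℤ) :
    (intNearlySymmetric n p k).map (fun m : ℤ => (m : ℝ)) = nearlySymmetric n p k := by
  simp [intNearlySymmetric, nearlySymmetric]

theorem nodup_map_range_add_two_mul (p : ℕ) (c : ℤ) :
    ((Multiset.range p).map fun j : ℕ => c + 2 * (j : ℤ)).Nodup :=
  (Multiset.nodup_range p).map fun i j h => by simpa using h

theorem count_intNearlySymmetric_le (n p : ℕ) (k m : ℤ) :
    (intNearlySymmetric n p k).count m ≤ 2 := by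
  rw [intNearlySymmetric, Multiset.count_add]
  exact add_le_add (Multiset.nodup_iff_count_le_one.1 (nodup_map_range_add_two_mul p _) m)
    (Multiset.nodup_iff_count_le_one.1 (nodup_map_range_add_two_mul p _) m)

/-- The reflection about `p - n / 2` interchanges the two progressions. -/
theorem sub_mem_intNearlySymmetric {n p : ℕ} {k m : ℤ} (hm : m ∈ intNearlySymmetric n p k) :
    2 * (p : ℤ) - n - m ∈ intNearlySymmetric n p k := by
  simp only [intNearlySymmetric, Multiset.mem_add, Multiset.mem_map, Multiset.mem_range] at hm ⊢
  rcases hm with ⟨j, hj, rfl⟩ | ⟨j, hj, rfl⟩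
  · exact Or.inr ⟨p - 1 - j, by omega, by omega⟩
  · exact Or.inl ⟨p - 1 - j, by omega, by omega⟩

/-- For `n = 2 * p` the two progressions are negatives of each other. -/
theorem isSymmetric_nearlySymmetric (p : ℕ) (k : ℤ) :
    IsSymmetric (nearlySymmetric (2 * p) p k) := by
  have h : ∀ c d : ℤ, c + d = 2 - 2 * p →
      ((Multiset.range p).map fun j : ℕ => c + 2 * (j : ℤ)).map (fun m => -m) =
        (Multiset.range p).map fun j : ℕ => d + 2 * (j : ℤ) := by
    intro c d hcd
    refine (((nodup_map_range_add_two_mul p c).map neg_injective).ext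
      (nodup_map_range_add_two_mul p d)).2 fun m => ?_
    simp only [Multiset.mem_map, Multiset.mem_range, exists_exists_and_eq_and]
    constructor
    · rintro ⟨j, hj, rfl⟩
      exact ⟨p - 1 - j, by omega, by omega⟩
    · rintro ⟨j, hj, rfl⟩
      exact ⟨p - 1 - j, by omega, by omega⟩
  have h1 : (intNearlySymmetric (2 * p) p k).map (fun m => -m) = intNearlySymmetric (2 * p) p k := by
    rw [intNearlySymmetric, Multiset.map_add, h k (-((2 * p : ℕ) : ℤ) - k + 2) (by push_cast; ring),
      h (-((2 * p : ℕ) : ℤ) - k + 2) k (by push_cast; ring), add_comm]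
  rw [IsSymmetric, ← map_intNearlySymmetric]
  conv_rhs => rw [← h1]
  simp [Multiset.map_map]

/-- The set of entries is symmetric about `p - n / 2 ≠ 0`, so `-μ` is not an entry if `μ` is an entry
of maximal absolute value. In particular this `μ` is not `0`. -/
theorem altValue_nearlySymmetric_ne_zero {n p : ℕ} (hp : 1 ≤ p) (hn : n ≠ 2 * p) (k : ℤ) :
    altValue (nearlySymmetric n p k) ≠ 0 := by
  rw [← map_intNearlySymmetric]
  have hmem : k ∈ intNearlySymmetric n p k := by
    rw [intNearlySymmetric, Multiset.mem_add]
    exact Or.inl (Multiset.mem_map.2 ⟨0, Multiset.mem_range.2 hp, by simp⟩)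
  obtain ⟨μ, hμ, hmax⟩ := Finset.exists_max_image (intNearlySymmetric n p k).toFinset
    (fun m => |m|) ⟨k, Multiset.mem_toFinset.2 hmem⟩
  simp only [Multiset.mem_toFinset] at hμ hmax
  have h1 := hmax _ (sub_mem_intNearlySymmetric hμ)
  refine intAltValue_ne_zero hμ ?_ (fun m hm hne => ?_) (count_intNearlySymmetric_le n p k)
  · rintro rfl
    rw [abs_zero, abs_nonpos_iff] at h1
    omega
  · refine lt_of_le_of_ne (hmax m hm) fun h => ?_
    rcases abs_eq_abs.1 h with h | rfl
    · exact hne h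
    · have h2 := hmax _ (sub_mem_intNearlySymmetric hm)
      rw [abs_le] at h1 h2
      have h3 : |μ| = μ ∨ |μ| = -μ := abs_choice μ
      omega

/-- The value at `0` of the antiperiodic spline is nonzero for the vectors `Λ` of both kinds. -/
theorem altSeries_ne_zero {p : ℕ} (hp : 1 ≤ p)
    (hcard : (l₀ ::ₘ ((l :: L : List ℝ) : Multiset ℝ)).card = 2 * p)
    (hΛ : IsSymmetric (l₀ ::ₘ ((l :: L : List ℝ) : Multiset ℝ)) ∨ ∃ (n : ℕ) (k : ℤ), 1 ≤ n ∧
      l₀ ::ₘ ((l :: L : List ℝ) : Multiset ℝ) = nearlySymmetric n p k) :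
    altSeries l₀ (l :: L) 0 ≠ 0 := by
  have hsymm : IsSymmetric (l₀ ::ₘ ((l :: L : List ℝ) : Multiset ℝ)) →
      altSeries l₀ (l :: L) 0 ≠ 0 := by
    intro h
    obtain ⟨M, hM⟩ := h.exists_eq_add_neg hcard
    refine altSeries_ne_zero_of_eq_add_neg (M := M) ?_ hM
    rintro rfl
    simp at hM
  rcases hΛ with h | ⟨n, k, -, h⟩
  · exact hsymm h
  · by_cases hn : n = 2 * p
    · subst hn
      exact hsymm (h ▸ isSymmetric_nearlySymmetric p k)
    · have h1 := altValue_nearlySymmetric_ne_zero hp hn k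
      rw [← h, altValue_coe] at h1
      exact fun h0 => h1 (by rw [h0, zero_div])

end

/-! ### The fundamental spline and the Shannon formula -/

section

variable {l₀ l : ℝ} {L : List ℝ} {a b c d : ℤ → ℂ} {t s : ℝ} {f g : ℝ → ℂ} {Λ : Multiset ℝ}

/-- Solution by the geometric series `c m = ∑ n, β ^ n * d (m + ε * n)`. -/
theorem exists_summable_eq_add_mul {β : ℂ} (hβ : ‖β‖ < 1) (hd : Summable fun m => ‖d m‖) (ε : ℤ) :
    ∃ c : ℤ → ℂ, (Summable fun m => ‖c m‖) ∧ ∀ m, c m = d m + β * c (m + ε) := by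
  -- a shear, which reduces the double series to a product of two summable families
  let e : ℤ × ℕ ≃ ℤ × ℕ :=
    { toFun := fun x => (x.1 + ε * x.2, x.2)
      invFun := fun x => (x.1 - ε * x.2, x.2)
      left_inv := fun x => by simp
      right_inv := fun x => by simp }
  have h1 : Summable fun x : ℤ × ℕ => ‖d (x.1 + ε * x.2) * β ^ x.2‖ := by
    have h2 : Summable fun n : ℕ => ‖β ^ n‖ := by
      simpa only [norm_pow] using summable_geometric_of_lt_one (norm_nonneg β) hβ
    exact (e.summable_iff (f := fun x : ℤ × ℕ => ‖d x.1 * β ^ x.2‖)).2 (hd.mul_norm h2)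
  refine ⟨fun m => ∑' n : ℕ, d (m + ε * n) * β ^ n, ?_, fun m => ?_⟩
  · exact Summable.of_nonneg_of_le (fun _ => norm_nonneg _)
      (fun m => norm_tsum_le_tsum_norm (h1.prod_factor m)) h1.prod
  · have h2 : ∑' n : ℕ, d (m + ε * n) * β ^ n = d (m + ε * (0 : ℕ)) * β ^ 0 +
        ∑' n : ℕ, d (m + ε * (n + 1 : ℕ)) * β ^ (n + 1) :=
      (h1.of_norm.prod_factor m).tsum_eq_zero_add
    beta_reduce
    rw [h2]
    simp only [Nat.cast_zero, mul_zero, add_zero, pow_zero, mul_one]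
    rw [← tsum_mul_left]
    congr 1
    refine tsum_congr fun n => ?_
    rw [pow_succ]
    push_cast
    rw [show m + ε * (n + 1) = m + ε + ε * n by ring]
    ring

theorem summable_norm_comp_add (hc : Summable fun m => ‖c m‖) (k : ℤ) :
    Summable fun m => ‖c (m + k)‖ :=
  (Equiv.addRight k).summable_iff (f := fun m => ‖c m‖) |>.2 hc

theorem exists_summable_shift_sub_eq {α : ℂ} (hα : ‖α‖ ≠ 1) (hd : Summable fun m => ‖d m‖) :
    ∃ c : ℤ → ℂ, (Summable fun m => ‖c m‖) ∧ ∀ m, c (m - 1) - α * c m = d m := by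
  rcases lt_or_gt_of_ne hα with h | h
  · obtain ⟨c, hc, hcd⟩ := exists_summable_eq_add_mul h hd 1
    refine ⟨fun m => c (m + 1), summable_norm_comp_add hc 1, fun m => ?_⟩
    simp only [sub_add_cancel]
    rw [hcd m]
    ring
  · have hα0 : α ≠ 0 := by rintro rfl; simp at h; linarith
    have hα1 : ‖α⁻¹‖ < 1 := by
      rw [norm_inv]
      exact inv_lt_one_of_one_lt₀ h
    obtain ⟨c, hc, hcd⟩ := exists_summable_eq_add_mul hα1 hd (-1)
    refine ⟨fun m => -α⁻¹ * c m, ?_, fun m => ?_⟩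
    · simp only [norm_mul]
      exact hc.mul_left _
    · simp only [← sub_eq_add_neg] at hcd
      have := hcd m
      field_simp at this ⊢
      linear_combination this

/-- The operator `(shift c) m = c (m - 1)` on sequences. -/
def shift : Module.End ℂ (ℤ → ℂ) := LinearMap.funLeft ℂ ℂ fun m : ℤ => m - 1

theorem shift_pow_apply (r : ℕ) (c : ℤ → ℂ) (m : ℤ) : (shift ^ r) c m = c (m - r) := by
  induction r generalizing m with
  | zero => simp
  | succ r ih =>
    rw [pow_succ', Module.End.mul_apply, shift, LinearMap.funLeft_apply, ← shift, ih]
    congr 1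
    push_cast
    ring

/-- `P(shift)` maps the summable sequences onto themselves if `P` has no zeros on the unit circle:
this reduces to linear factors, which are inverted by geometric series. -/
theorem exists_summable_aeval_shift_eq {P : ℂ[X]} (hP : P ≠ 0)
    (hroots : ∀ α : ℂ, ‖α‖ = 1 → P.eval α ≠ 0) (hd : Summable fun m => ‖d m‖) :
    ∃ c : ℤ → ℂ, (Summable fun m => ‖c m‖) ∧ aeval shift P c = d := by
  have key : ∀ s : Multiset ℂ, (∀ α ∈ s, ‖α‖ ≠ 1) → ∀ d : ℤ → ℂ, (Summable fun m => ‖d m‖) →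
      ∃ c : ℤ → ℂ, (Summable fun m => ‖c m‖) ∧
        aeval shift (s.map fun α => X - C α).prod c = d := by
    intro s
    induction s using Multiset.induction_on with
    | empty => exact fun _ d hd => ⟨d, hd, by simp⟩
    | cons α s ih =>
      intro hs d hd
      obtain ⟨c, hc, hcd⟩ := exists_summable_shift_sub_eq (hs α (Multiset.mem_cons_self _ _)) hd
      obtain ⟨c', hc', hcd'⟩ := ih (fun β hβ => hs β (Multiset.mem_cons_of_mem hβ)) c hc
      refine ⟨c', hc', ?_⟩
      rw [Multiset.map_cons, Multiset.prod_cons, map_mul, Module.End.mul_apply, hcd']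
      ext m
      rw [← hcd m]
      simp [shift, LinearMap.funLeft_apply]
  have hsplit := (IsAlgClosed.splits P).eq_prod_roots
  have hlead : P.leadingCoeff ≠ 0 := leadingCoeff_ne_zero.2 hP
  obtain ⟨c, hc, hcd⟩ := key P.roots (fun α hα h => hroots α h (isRoot_of_mem_roots hα)) d hd
  refine ⟨fun m => P.leadingCoeff⁻¹ * c m, ?_, ?_⟩
  · simp only [norm_mul]
    exact hc.mul_left _
  · have h1 : aeval shift P = algebraMap ℂ (Module.End ℂ (ℤ → ℂ)) P.leadingCoeff *
        aeval shift (P.roots.map fun α => X - C α).prod := by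
      conv_lhs => rw [hsplit, map_mul, aeval_C]
    rw [h1, Module.End.mul_apply]
    have : (fun m => P.leadingCoeff⁻¹ * c m) = P.leadingCoeff⁻¹ • c := rfl
    rw [this, map_smul, hcd, Module.algebraMap_end_apply, smul_smul, mul_inv_cancel₀ hlead, one_smul]

/-- The values at the integers are a convolution of the coefficients with the values of the
B-spline. -/
theorem splineSeries_intCast (j : ℤ) : splineSeries l₀ L a j =
    ∑ r ∈ Finset.range (L.length + 1), bSpline l₀ L r * a (j - r) := by
  rw [splineSeries_eq_sum subset_rfl, Int.floor_intCast]
  refine Finset.sum_nbij' (fun i => (j - i).toNat) (fun r => j - r) ?_ ?_ ?_ ?_ ?_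
  · intro i hi
    rw [Finset.mem_Icc] at hi
    rw [Finset.mem_range]
    omega
  · intro r hr
    rw [Finset.mem_range] at hr
    rw [Finset.mem_Icc]
    omega
  · intro i hi
    rw [Finset.mem_Icc] at hi
    omega
  · intro r hr
    omega
  · intro i hi
    rw [Finset.mem_Icc] at hi
    have h : ((j - i).toNat : ℤ) = j - i := Int.toNat_of_nonneg (by omega)
    have h' : (((j - i).toNat : ℕ) : ℝ) = (j : ℝ) - i := by
      exact_mod_cast congrArg (Int.cast (R := ℝ)) h
    rw [h, h', mul_comm, sub_sub_cancel]

theorem splineSeries_sub_int (k : ℤ) :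
    splineSeries l₀ L a (t - k) = splineSeries l₀ L (fun j => a (j - k)) t := by
  have := splineSeries_add_int (l₀ := l₀) (L := L) (a := a) (t := t) (-k)
  rwa [Int.cast_neg, ← sub_eq_add_neg] at this

/-- The coefficients `c` of the fundamental spline `S = ∑ j, c j * B (· - j)`, which satisfies
`∑ r, B r * S (t - r) = B t`: they form the inverse of the sequence `B r` for convolution of summable
sequences. -/
theorem exists_fundamental_coeff (h : ∀ ξ : ℝ, splineSeries l₀ L (fun j => exp (I * ξ) ^ j) 0 ≠ 0) :
    ∃ c : ℤ → ℂ, (Summable fun m => ‖c m‖) ∧ ∀ t,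
      ∑ r ∈ Finset.range (L.length + 1), bSpline l₀ L r * splineSeries l₀ L c (t - r) =
        bSpline l₀ L t := by
  set P : ℂ[X] := ∑ r ∈ Finset.range (L.length + 1), C (bSpline l₀ L r) * X ^ r with hP
  have hroots : ∀ α : ℂ, ‖α‖ = 1 → P.eval α ≠ 0 := by
    intro α hα
    -- the sum with coefficients `w ^ j` is `P` evaluated at `w⁻¹`, hence the sign of the argument
    have h1 := h (-arg α)
    have h2 : exp (I * ((-arg α : ℝ) : ℂ)) = α⁻¹ := by
      have h3 := norm_mul_exp_arg_mul_I α
      rw [hα, ofReal_one, one_mul] at h3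
      rw [ofReal_neg, mul_neg, exp_neg, mul_comm, h3]
    have h3 := splineSeries_intCast (l₀ := l₀) (L := L) (a := fun j => α⁻¹ ^ j) 0
    rw [h2] at h1
    rw [Int.cast_zero] at h3
    rw [h3] at h1
    convert h1 using 1
    rw [hP, eval_finsetSum]
    refine Finset.sum_congr rfl fun r _ => ?_
    simp
  have hP0 : P ≠ 0 := fun h0 => hroots 1 (by simp) (by rw [h0, eval_zero])
  obtain ⟨c, hc, hcd⟩ := exists_summable_aeval_shift_eq (d := Pi.single 0 1) hP0 hroots
    (summable_of_ne_finset_zero (s := {0}) fun m hm => by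
      rw [Finset.mem_singleton] at hm
      simp [hm])
  refine ⟨c, hc, fun t => ?_⟩
  have h1 : ∀ r : ℕ, splineSeries l₀ L c (t - r) = splineSeries l₀ L (fun j => c (j - r)) t :=
    fun r => by exact_mod_cast splineSeries_sub_int (l₀ := l₀) (L := L) (a := c) (t := t) r
  simp only [h1]
  rw [← splineSeries_sum]
  change _ = splineSeries l₀ L (Pi.single 0 1) t
  rw [← hcd]
  congr 1
  ext m
  rw [hP, map_sum, LinearMap.sum_apply, Finset.sum_apply]
  refine Finset.sum_congr rfl fun r _ => ?_
  rw [map_mul, aeval_C, map_pow, aeval_X, Module.End.mul_apply, Module.algebraMap_end_apply,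
    Pi.smul_apply, shift_pow_apply, smul_eq_mul]

/-- The maxima of the series over the unit intervals are summable. -/
theorem integrable_splineSeries (hc : Summable fun m => ‖c m‖) :
    Integrable (splineSeries l₀ (l :: L) c) := by
  obtain ⟨C, hC, hB⟩ := exists_norm_bSpline_le l₀ (l :: L)
  let F : C(ℝ, ℂ) := ⟨splineSeries l₀ (l :: L) c, continuous_splineSeries_cons ..⟩
  refine Real.integrable_of_summable_norm_Icc (f := F) ?_
  set W : Finset ℤ := Finset.Icc (-((l :: L).length : ℤ)) 1
  have hs : Summable fun n : ℤ => ∑ i ∈ W, ‖c (n + i)‖ * C :=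
    summable_sum fun i _ => (summable_norm_comp_add hc i).mul_right C
  refine Summable.of_nonneg_of_le (fun _ => norm_nonneg _) (fun n => ?_) hs
  rw [ContinuousMap.norm_le _ (by positivity)]
  rintro ⟨x, hx⟩
  change ‖splineSeries l₀ (l :: L) c (x + n)‖ ≤ _
  have h1 : ⌊x⌋ ≤ 1 := by simpa using Int.floor_le_floor hx.2
  have h0 : 0 ≤ ⌊x⌋ := Int.floor_nonneg.2 hx.1
  rw [splineSeries_add_int, splineSeries_eq_sum (W := W) (Finset.Icc_subset_Icc (by omega) h1)]
  refine norm_sum_le_of_le _ fun i _ => ?_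
  rw [norm_mul, add_comm i n]
  gcongr
  exact hB _

theorem summable_splineSeries_sub_int (hc : Summable fun m => ‖c m‖) (t : ℝ) :
    Summable fun j : ℤ => ‖splineSeries l₀ L c (t - j)‖ := by
  obtain ⟨C, hC, hB⟩ := exists_norm_bSpline_le l₀ L
  set W : Finset ℤ := Finset.Icc (⌊t⌋ - L.length) ⌊t⌋
  have hs : Summable fun j : ℤ => ∑ i ∈ W, ‖c (i - j)‖ * C := by
    refine summable_sum fun i _ => Summable.mul_right C ?_
    exact (Equiv.subLeft i).summable_iff (f := fun m => ‖c m‖) |>.2 hc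
  refine Summable.of_nonneg_of_le (fun _ => norm_nonneg _) (fun j => ?_) hs
  rw [splineSeries_sub_int, splineSeries_eq_sum subset_rfl]
  refine norm_sum_le_of_le _ fun i _ => ?_
  rw [norm_mul]
  gcongr
  exact hB _

theorem memLp_two_splineSeries (hc : Summable fun m => ‖c m‖) :
    MemLp (splineSeries l₀ (l :: L) c) 2 volume := by
  obtain ⟨C, hC, h⟩ := exists_norm_splineSeries_le l₀ (l :: L)
  have hb := h c (∑' m, ‖c m‖) fun j => hc.le_tsum j fun _ _ => norm_nonneg _
  have hi := integrable_splineSeries (l₀ := l₀) (l := l) (L := L) hc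
  rw [memLp_two_iff_integrable_sq_norm hi.aestronglyMeasurable]
  refine (hi.norm.const_mul (C * ∑' m, ‖c m‖)).mono' (hi.aestronglyMeasurable.norm.pow 2)
    (ae_of_all _ fun t => ?_)
  rw [norm_pow, norm_norm, pow_two]
  gcongr
  exact hb t

/-- Let `S` be the fundamental spline and `f = ∑ l, a l * B (· - l)`. By the relation between `S` and
`B`, both `f t` and `∑ j, S (t - j) * f j` equal `∑ r, B r * ∑ j, S (t - j) * a (j - r)`; the sum over
`r` is finite. -/
theorem hasSum_splineSeries_mul_intCast (hc : Summable fun m => ‖c m‖)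
    (hcB : ∀ t, ∑ r ∈ Finset.range (L.length + 1),
      bSpline l₀ L r * splineSeries l₀ L c (t - r) = bSpline l₀ L t)
    {M : ℝ} (ha : ∀ j, ‖a j‖ ≤ M) (t : ℝ) :
    HasSum (fun j : ℤ => splineSeries l₀ L c (t - j) * splineSeries l₀ L a j)
      (splineSeries l₀ L a t) := by
  set S := splineSeries l₀ L c with hS
  have hsum : ∀ t, Summable fun j : ℤ => S (t - j) * a j := fun t => by
    refine Summable.of_norm_bounded
      ((summable_splineSeries_sub_int (l₀ := l₀) (L := L) hc t).mul_right M) fun j => ?_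
    rw [norm_mul]
    gcongr
    exact ha j
  set T : ℕ → ℂ := fun r => ∑' j : ℤ, S (t - r - j) * a j with hT
  have h1 : ∀ r : ℕ, HasSum (fun j : ℤ => S (t - r - j) * a j) (T r) := fun r => (hsum _).hasSum
  -- the same series after the substitution `j ↦ j - r`
  have h2 : ∀ r : ℕ, HasSum (fun j : ℤ => S (t - j) * a (j - r)) (T r) := fun r => by
    rw [← (Equiv.addRight (r : ℤ)).hasSum_iff]
    convert h1 r using 2 with j
    simp only [Function.comp_apply, Equiv.coe_addRight, add_sub_cancel_right]
    push_cast
    rw [sub_sub, add_comm (j : ℝ)]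
  have h3 := hasSum_sum (s := Finset.range (L.length + 1))
    fun r _ => (h1 r).mul_left (bSpline l₀ L r)
  have h4 := hasSum_sum (s := Finset.range (L.length + 1))
    fun r _ => (h2 r).mul_left (bSpline l₀ L r)
  have h5 : ∑ r ∈ Finset.range (L.length + 1), bSpline l₀ L r * T r = splineSeries l₀ L a t := by
    have h6 : ∀ j : ℤ, ∑ r ∈ Finset.range (L.length + 1),
        bSpline l₀ L r * (S (t - r - j) * a j) = a j * bSpline l₀ L (t - j) := fun j => by
      rw [← hcB, Finset.mul_sum]
      refine Finset.sum_congr rfl fun r _ => ?_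
      rw [sub_right_comm]
      ring
    simp only [h6] at h3
    exact h3.unique (hasSum_splineSeries l₀ L a t)
  have h7 : ∀ j : ℤ, ∑ r ∈ Finset.range (L.length + 1),
      bSpline l₀ L r * (S (t - j) * a (j - r)) = S (t - j) * splineSeries l₀ L a j := fun j => by
    rw [splineSeries_intCast, Finset.mul_sum]
    refine Finset.sum_congr rfl fun r _ => ?_
    ring
  simp only [h7] at h4
  rwa [← h5]

theorem fourierHat_comp_sub (f : ℝ → ℂ) (r ξ : ℝ) :
    fourierHat (fun t => f (t - r)) ξ = exp (-(I * ξ * r)) * fourierHat f ξ := by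
  rw [fourierHat, fourierHat, ← integral_const_mul,
    ← integral_sub_right_eq_self (fun t : ℝ => exp (-(I * ξ * r)) * (exp (-(I * ξ * t)) * f t)) r]
  congr 1
  ext t
  rw [← mul_assoc, ← exp_add]
  congr 2
  push_cast
  ring

theorem phiStar_eq_sum (l₀ l : ℝ) (L : List ℝ) (ξ : ℝ) :
    phiStar (l₀ ::ₘ ((l :: L : List ℝ) : Multiset ℝ)) ξ =
      ∑ r ∈ Finset.range ((l :: L).length + 1), bSpline l₀ (l :: L) r * exp (-(I * ξ)) ^ r := by
  have h := splineSeries_intCast (l₀ := l₀) (L := l :: L) (a := fun j => exp (I * ξ) ^ j) 0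
  rw [Int.cast_zero] at h
  rw [phiStar_eq, h]
  refine Finset.sum_congr rfl fun r _ => ?_
  simp [exp_neg]

/-- The relation between the fundamental spline and the B-spline, on the Fourier side. -/
theorem phiStar_mul_fourierHat (hc : Summable fun m => ‖c m‖)
    (hcB : ∀ t, ∑ r ∈ Finset.range ((l :: L).length + 1),
      bSpline l₀ (l :: L) r * splineSeries l₀ (l :: L) c (t - r) = bSpline l₀ (l :: L) t) (ξ : ℝ) :
    phiStar (l₀ ::ₘ ((l :: L : List ℝ) : Multiset ℝ)) ξ *
      fourierHat (splineSeries l₀ (l :: L) c) ξ = fourierHat (bSpline l₀ (l :: L)) ξ := by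
  have hi := integrable_splineSeries (l₀ := l₀) (l := l) (L := L) hc
  have hexp : ∀ t : ℝ, ‖exp (-(I * ξ * t))‖ ≤ 1 := fun t => by
    rw [show -(I * (ξ : ℂ) * t) = ((-(ξ * t) : ℝ) : ℂ) * I by push_cast; ring,
      norm_exp_ofReal_mul_I]
  have hi' : ∀ r : ℕ, Integrable fun t : ℝ => exp (-(I * ξ * t)) *
      splineSeries l₀ (l :: L) c (t - r) := fun r =>
    (hi.comp_sub_right (r : ℝ)).bdd_mul (c := 1) (by fun_prop) (ae_of_all _ hexp)
  have h1 : fourierHat (bSpline l₀ (l :: L)) ξ = ∑ r ∈ Finset.range ((l :: L).length + 1),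
      bSpline l₀ (l :: L) r *
        fourierHat (fun t => splineSeries l₀ (l :: L) c (t - r)) ξ := by
    have h0 : ∀ t : ℝ, exp (-(I * ξ * t)) * bSpline l₀ (l :: L) t =
        ∑ r ∈ Finset.range ((l :: L).length + 1), bSpline l₀ (l :: L) r *
          (exp (-(I * ξ * t)) * splineSeries l₀ (l :: L) c (t - r)) := fun t => by
      rw [← hcB t, Finset.mul_sum]
      exact Finset.sum_congr rfl fun r _ => mul_left_comm _ _ _
    simp only [fourierHat, h0]
    rw [integral_finsetSum _ fun r _ => (hi' r).const_mul _]
    simp_rw [integral_const_mul]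
  rw [h1, phiStar_eq_sum, Finset.sum_mul]
  refine Finset.sum_congr rfl fun r _ => ?_
  rw [fourierHat_comp_sub, ← exp_nat_mul, mul_assoc]
  congr 3
  push_cast
  ring

/-- `φ*` is a continuous function of the point `exp (-(I * ξ))` of the unit circle. -/
theorem exists_norm_inv_phiStar_le
    (h : ∀ ξ, phiStar (l₀ ::ₘ ((l :: L : List ℝ) : Multiset ℝ)) ξ ≠ 0) :
    ∃ K, ∀ ξ, ‖(phiStar (l₀ ::ₘ ((l :: L : List ℝ) : Multiset ℝ)) ξ)⁻¹‖ ≤ K := by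
  set P : ℂ → ℂ := fun z =>
    ∑ r ∈ Finset.range ((l :: L).length + 1), bSpline l₀ (l :: L) r * z ^ r with hP
  have hPc : Continuous P := by fun_prop
  have hP0 : ∀ z ∈ Metric.sphere (0 : ℂ) 1, P z ≠ 0 := by
    intro z hz
    have h1 := h (-arg z)
    have h3 := norm_mul_exp_arg_mul_I z
    rw [mem_sphere_zero_iff_norm.1 hz, ofReal_one, one_mul] at h3
    rw [phiStar_eq_sum] at h1
    rw [ofReal_neg, mul_neg, neg_neg, mul_comm, h3] at h1
    exact h1
  obtain ⟨K, hK⟩ := (isCompact_sphere (0 : ℂ) 1).exists_bound_of_continuousOn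
    (hPc.continuousOn.inv₀ hP0)
  refine ⟨K, fun ξ => ?_⟩
  have := hK (exp (-(I * ξ))) (by
    rw [mem_sphere_zero_iff_norm, show -(I * (ξ : ℂ)) = ((-ξ : ℝ) : ℂ) * I by push_cast; ring,
      norm_exp_ofReal_mul_I])
  rwa [phiStar_eq_sum]

/-- Both have the Fourier transform `φ̂ / φ*`, which is integrable since `φ*` is bounded away from
zero. -/
theorem shannonWalter_eq
    (h : ∀ ξ, phiStar (l₀ ::ₘ ((l :: L : List ℝ) : Multiset ℝ)) ξ ≠ 0)
    (hc : Summable fun m => ‖c m‖)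
    (hcB : ∀ t, ∑ r ∈ Finset.range ((l :: L).length + 1),
      bSpline l₀ (l :: L) r * splineSeries l₀ (l :: L) c (t - r) = bSpline l₀ (l :: L) t) :
    shannonWalter (l₀ ::ₘ ((l :: L : List ℝ) : Multiset ℝ)) = splineSeries l₀ (l :: L) c := by
  have h1 : (fun ξ => fourierHat (tbSpline (l₀ ::ₘ ((l :: L : List ℝ) : Multiset ℝ))) ξ /
      phiStar (l₀ ::ₘ ((l :: L : List ℝ) : Multiset ℝ)) ξ) =
      fourierHat (splineSeries l₀ (l :: L) c) := by
    ext ξ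
    rw [tbSpline_eq_bSpline, ← phiStar_mul_fourierHat hc hcB, mul_div_cancel_left₀ _ (h ξ)]
  have hi := integrable_splineSeries (l₀ := l₀) (l := l) (L := L) hc
  rw [shannonWalter, h1]
  refine fourierHatInv_fourierHat (continuous_splineSeries_cons ..) hi ?_
  obtain ⟨K, hK⟩ := exists_norm_inv_phiStar_le h
  refine ((integrable_fourierHat_bSpline l₀ l L).norm.const_mul K).mono'
    (continuous_fourierHat hi).aestronglyMeasurable (ae_of_all _ fun ξ => ?_)
  rw [← phiStar_mul_fourierHat hc hcB, norm_mul, ← mul_assoc]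
  refine le_mul_of_one_le_left (norm_nonneg _) ?_
  calc (1 : ℝ) = ‖(phiStar (l₀ ::ₘ ((l :: L : List ℝ) : Multiset ℝ)) ξ)⁻¹‖ *
        ‖phiStar (l₀ ::ₘ ((l :: L : List ℝ) : Multiset ℝ)) ξ‖ := by
        rw [← norm_mul, inv_mul_cancel₀ (h ξ), norm_one]
    _ ≤ _ := by
      gcongr
      exact hK ξ

end

end ExpSpline

end

theorem mainTheorem3 (p : ℕ) (hp : 1 ≤ p) (Λ : Multiset ℝ) (hcard : Λ.card = 2 * p)
    (hΛ : ExpSpline.IsSymmetric Λ ∨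
      ∃ (n : ℕ) (k : ℤ), 1 ≤ n ∧ Λ = ExpSpline.nearlySymmetric n p k) :
    (∀ ξ : ℝ, ExpSpline.phiStar Λ ξ ≠ 0) ∧
    ExpSpline.shannonWalter Λ ∈ ExpSpline.V₀ Λ ∧
    Integrable (ExpSpline.shannonWalter Λ) ∧
    (∀ ξ : ℝ, ExpSpline.fourierHat (ExpSpline.shannonWalter Λ) ξ =
      ExpSpline.fourierHat (ExpSpline.tbSpline Λ) ξ / ExpSpline.phiStar Λ ξ) ∧
    ∀ f ∈ ExpSpline.V₀ Λ, ∀ t : ℝ,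
      HasSum (fun j : ℤ => ExpSpline.shannonWalter Λ (t - j) * f (j : ℝ)) (f t) := by
  obtain ⟨A, rfl⟩ : ∃ A : List ℝ, Λ = (A : Multiset ℝ) := ⟨Λ.toList, Λ.coe_toList.symm⟩
  match A, hcard, hΛ with
  | [], hcard, _ => simp at hcard; omega
  | [_], hcard, _ => simp at hcard; omega
  | l₀ :: l :: L, hcard, hΛ =>
    rw [← Multiset.cons_coe l₀] at *
    have hφ := ExpSpline.phiStar_ne_zero_of_altSeries_ne_zero
      (ExpSpline.altSeries_ne_zero hp hcard hΛ)
    obtain ⟨c, hc, hcB⟩ := ExpSpline.exists_fundamental_coeff (l₀ := l₀) (L := l :: L)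
      fun ξ => by rw [← ExpSpline.phiStar_eq]; exact hφ ξ
    rw [ExpSpline.shannonWalter_eq hφ hc hcB]
    refine ⟨hφ, ⟨ExpSpline.splineSeries_mem_cardinalSplines .., ExpSpline.memLp_two_splineSeries hc⟩,
      ExpSpline.integrable_splineSeries hc, fun ξ => ?_, fun f hf t => ?_⟩
    · rw [ExpSpline.tbSpline_eq_bSpline, ← ExpSpline.phiStar_mul_fourierHat hc hcB,
        mul_div_cancel_left₀ _ (hφ ξ)]
    · obtain ⟨a, rfl⟩ := ExpSpline.exists_eq_splineSeries hf.1
      obtain ⟨M, hM⟩ := ExpSpline.exists_norm_coeff_le hf.2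
      exact ExpSpline.hasSum_splineSeries_mul_intCast hc hcB hM t
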